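/- Let $d_{\mathrm h}, d_{\mathrm p} \ge 1$ be integers, $d = d_{\mathrm h} + d_{\mathrm p}$, and $\mathbb T = \mathbb R/2\pi\mathbb Z$. Let $A, B, K$ be real $d\times d$ matrices, written by blocks according to the decomposition $d = d_{\mathrm h}+d_{\mathrm p}$, with \[ B = \begin{pmatrix} 0 & 0\\ 0 & D\end{pmatrix}, \qquad A = \begin{pmatrix} A' & A_{12}\\ A_{21} & A_{22}\end{pmatrix}. \] Assume that every complex eigenvalue of $D$ has positive real part, and that $A'$ is diagonalizable with only real eigenvalues. Let $\mathcal L$ be the unbounded operator on $L^2(\mathbb T)^d$ (complex-valued functions) with domain $H^1(\mathbb T)^{d_{\mathrm h}} \times H^2(\mathbb T)^{d_{\mathrm p}}$ defined by $\mathcal L f = -B\partial_x^2 f + A\partial_x f + K f$. Then there is exactly one strongly continuous semigroup $(\mathrm e^{-t\mathcal L})_{t\ge 0}$ of bounded operators on $L^2(\mathbb T)^d$ whose generator is the closure of $-\mathcal L$, and it has the following properties. 1. For every $f_0 \in H^1(\mathbb T)^{d_{\mathrm h}} \times L^2(\mathbb T)^{d_{\mathrm p}}$ and every $t > 0$, $\mathrm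 e^{-t\mathcal L} f_0 \in H^1(\mathbb T)^d$. 2. If moreover $A_{12} = 0$, then for every $f_0 \in H^2(\mathbb T)^{d_{\mathrm h}} \times L^2(\mathbb T)^{d_{\mathrm p}}$ and every $t > 0$, $\mathrm e^{-t\mathcal L} f_0 \in H^2(\mathbb T)^d$. -/

import Mathlib

open MeasureTheory Filter Topology
open scoped NNReal ContDiff

noncomputable section

namespace ParabolicTransport

instance two_pi_fact : Fact (0 < 2 * Real.pi) := ⟨Real.two_pi_pos⟩

/-- The torus `ℝ / 2πℤ`. -/
abbrev Torus : Type := AddCircle (2 * Real.pi)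

/-- Complex-valued `L²` functions on the torus. The measure is the invariant measure of total
mass one, i.e. Lebesgue measure divided by `2π`. -/
abbrev L2T : Type := Lp ℂ 2 (AddCircle.haarAddCircle : Measure Torus)

/-- `g` is the weak derivative of `f`: `∫ f φ' = - ∫ g φ` for every smooth `φ` on the torus. Here
`ψ` is the derivative of `φ`. -/
def IsWeakDeriv (f g : L2T) : Prop :=
  ∀ φ ψ : Torus → ℂ, ContDiff ℝ ∞ (fun x : ℝ => φ (x : Torus)) →
    (∀ x : ℝ, HasDerivAt (fun y : ℝ => φ (y : Torus)) (ψ (x : Torus)) x) →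
      ∫ x, f x * ψ x ∂AddCircle.haarAddCircle = - ∫ x, g x * φ x ∂AddCircle.haarAddCircle

/-- Membership in the Sobolev space `H^k` of the torus: `f` has `k` successive weak derivatives
in `L²`. -/
def MemH : ℕ → L2T → Prop
  | 0, _ => True
  | k + 1, f => ∃ g, IsWeakDeriv f g ∧ MemH k g

theorem IsWeakDeriv.fourierCoeff_eq {f g : L2T} (h : IsWeakDeriv f g) (n : ℤ) :
    fourierCoeff g n = Complex.I * n * fourierCoeff f n := by
  have hd : ∀ x : ℝ, HasDerivAt (fun y : ℝ => (fourier (-n) (y : Torus) : ℂ))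
      ((fun z : Torus => -(Complex.I * n) * fourier (-n) z) (x : Torus)) x := by
    intro x
    have := hasDerivAt_fourier_neg (2 * Real.pi) n x
    convert this using 1
    have hpi : (Real.pi : ℂ) ≠ 0 := by exact_mod_cast Real.pi_ne_zero
    push_cast
    field_simp
  have hs : ContDiff ℝ ∞ (fun x : ℝ => (fourier (-n) (x : Torus) : ℂ)) := by
    simp only [fourier_coe_apply]
    have h1 : ContDiff ℝ ∞ (fun x : ℝ => (x : ℂ)) := Complex.ofRealCLM.contDiff
    fun_prop
  have key := h _ (fun z : Torus => -(Complex.I * n) * fourier (-n) z) hs hd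
  have e1 : ∫ x, f x * (-(Complex.I * n) * fourier (-n) x) ∂AddCircle.haarAddCircle
      = -(Complex.I * n) * fourierCoeff f n := by
    rw [fourierCoeff, ← integral_const_mul]
    congr 1
    ext x
    simp only [smul_eq_mul]
    ring
  have e2 : ∫ x, g x * fourier (-n) x ∂AddCircle.haarAddCircle = fourierCoeff g n := by
    rw [fourierCoeff]
    congr 1
    ext x
    simp only [smul_eq_mul]
    ring
  rw [e1, e2] at key
  linear_combination key

theorem IsWeakDeriv.unique {f g₁ g₂ : L2T} (h₁ : IsWeakDeriv f g₁) (h₂ : IsWeakDeriv f g₂) :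
    g₁ = g₂ := by
  apply (fourierBasis (T := 2 * Real.pi)).repr.injective
  ext n
  rw [fourierBasis_repr, fourierBasis_repr, h₁.fourierCoeff_eq, h₂.fourierCoeff_eq]

open Classical in
/-- The weak derivative `∂ₓ f`, for `f` in `H¹` (and `0` for other `f`). -/
def weakDeriv (f : L2T) : L2T := if h : ∃ g, IsWeakDeriv f g then h.choose else 0

theorem IsWeakDeriv.weakDeriv_eq {f g : L2T} (h : IsWeakDeriv f g) : weakDeriv f = g := by
  have hex : ∃ g, IsWeakDeriv f g := ⟨g, h⟩
  rw [weakDeriv, dif_pos hex]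
  exact hex.choose_spec.unique h

/-- A strongly continuous one-parameter semigroup of bounded operators. -/
structure IsC0Semigroup {X : Type*} [NormedAddCommGroup X] [NormedSpace ℂ X]
    (S : ℝ≥0 → X →L[ℂ] X) : Prop where
  map_zero : S 0 = ContinuousLinearMap.id ℂ X
  map_add : ∀ s t, S (s + t) = (S s).comp (S t)
  continuous_orbit : ∀ x, Continuous fun t => S t x

/-- The graph of the infinitesimal generator: the pairs `(x, y)` with
`(S t x - x) / t → y` as `t → 0⁺`. -/
def generatorGraph {X : Type*} [NormedAddCommGroup X] [NormedSpace ℂ X]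
    (S : ℝ≥0 → X →L[ℂ] X) : Set (X × X) :=
  {p | Tendsto (fun t : ℝ≥0 => (((t : ℝ) : ℂ)⁻¹) • (S t p.1 - p.1)) (𝓝[>] 0) (𝓝 p.2)}

/-- The state space `L²(𝕋)^d`, `d = dh + dp`; the first `dh` components are the hyperbolic ones
and the last `dp` components are the parabolic ones. -/
abbrev State (dh dp : ℕ) : Type := Fin dh ⊕ Fin dp → L2T

/-- The space `H^k(𝕋)^dh × H^l(𝕋)^dp`. -/
def sobolev (dh dp k l : ℕ) : Set (State dh dp) :=
  {f | (∀ i, MemH k (f (Sum.inl i))) ∧ ∀ j, MemH l (f (Sum.inr j))}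

/-- The expression `ℒ f = -B ∂ₓ² f + A ∂ₓ f + K f`. -/
def opL {dh dp : ℕ} (A B K : Matrix (Fin dh ⊕ Fin dp) (Fin dh ⊕ Fin dp) ℝ)
    (f : State dh dp) : State dh dp := fun i =>
  -(∑ j, B i j • weakDeriv (weakDeriv (f j))) + ∑ j, A i j • weakDeriv (f j) + ∑ j, K i j • f j

/-- The graph of the unbounded operator `-ℒ` with domain `H¹(𝕋)^dh × H²(𝕋)^dp`. -/
def negLGraph {dh dp : ℕ} (A B K : Matrix (Fin dh ⊕ Fin dp) (Fin dh ⊕ Fin dp) ℝ) :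
    Set (State dh dp × State dh dp) :=
  {p | p.1 ∈ sobolev dh dp 1 2 ∧ p.2 = -opL A B K p.1}

/-- `S t = e^{-tℒ}`: `S` is a strongly continuous semigroup on `L²(𝕋)^d` whose generator is the
closure of `-ℒ`. (The closure cannot be omitted: `ℒ` with domain `H¹(𝕋)^dh × H²(𝕋)^dp` need not
be a closed operator when `0` is an eigenvalue of the hyperbolic block of `A`.) -/
def IsFreeSemigroup {dh dp : ℕ} (A B K : Matrix (Fin dh ⊕ Fin dp) (Fin dh ⊕ Fin dp) ℝ)
    (S : ℝ≥0 → State dh dp →L[ℂ] State dh dp) : Prop :=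
  IsC0Semigroup S ∧ generatorGraph S = closure (negLGraph A B K)

/-- A square matrix is diagonalizable over the field of its coefficients. -/
def IsDiagonalizable {n : ℕ} {F : Type*} [Field F] (M : Matrix (Fin n) (Fin n) F) : Prop :=
  ∃ P : Matrix (Fin n) (Fin n) F, IsUnit P.det ∧
    ∃ v : Fin n → F, M = P * Matrix.diagonal v * P⁻¹

/-- A real matrix, seen as a complex matrix. -/
def toComplex {n : ℕ} (M : Matrix (Fin n) (Fin n) ℝ) : Matrix (Fin n) (Fin n) ℂ :=
  M.map (algebraMap ℝ ℂ)

end ParabolicTransport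

end

noncomputable section

namespace ParabolicTransport

/-! Fourier series turn the equation into independent linear systems x' = G_n x with G_n = -(n² B +
i n A + K), so the semigroup has to be the multiplier with symbol exp(t G_n). Everything rests on
bounds for these exponentials that are uniform in n; finitely many low frequencies are harmless.

For large r = |n|, split x into a transported part h and a damped part p, measured in adapted inner
products (`exists_isAdapted`). In eigenvector coordinates A' is real diagonal, so i n A' is
skew-Hermitian and does not affect the energy of h. In a suitable inner product D is strictly
accretive (`exists_accretive_embedding`), so p decays at a rate of order r². What remains is
coupling: p forces h with strength O(r^(2-k)), where k = 1 in general and k = 2 if A₁₂ = 0, while h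
forces p with strength O(r). With w of order r^(-k), the functional ‖h‖ + w‖p‖ grows at most at a
rate independent of r, because the damping of w‖p‖ absorbs the forcing of h. Hence h is controlled
by ‖h(0)‖ + ‖p(0)‖ / r^k, and p by an exponentially decaying term plus the same quantity divided by
r (`exists_transport_damping_estimate`). At t > 0 the exponential beats r², and multiplying by r^k
gives both smoothing claims.

The closure of -ℒ is the multiplier G_n on its maximal domain, because truncated Fourier series
approximate in the graph norm (`closure_negLGraph`). The uniform bounds make the multiplier
semigroup strongly continuous with this generator. For uniqueness, the Fourier coefficients of any
orbit starting in the domain of the generator solve the same linear ODE, and truncations are dense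
(`IsC0Semigroup.coeff_apply`). -/

/-! ### Fourier coefficients on the torus -/

/-- The `n`-th Fourier coefficient as a continuous linear functional on `L²`. -/
def fourierCoeffCLM (n : ℤ) : L2T →L[ℂ] ℂ := innerSL ℂ (fourierBasis (T := 2 * Real.pi) n)

theorem fourierCoeffCLM_apply (n : ℤ) (f : L2T) : fourierCoeffCLM n f = fourierCoeff f n := by
  rw [fourierCoeffCLM, innerSL_apply_apply, ← HilbertBasis.repr_apply_apply, fourierBasis_repr]

theorem ext_fourierCoeff {f g : L2T} (h : ∀ n, fourierCoeff f n = fourierCoeff g n) : f = g := by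
  apply (fourierBasis (T := 2 * Real.pi)).repr.injective
  ext n
  rw [fourierBasis_repr, fourierBasis_repr, h]

theorem hasSum_sq_fourierCoeff_L2T (f : L2T) :
    HasSum (fun n : ℤ => ‖fourierCoeff f n‖ ^ 2) (‖f‖ ^ 2) := by
  have h := hasSum_sq_fourierCoeff f
  have h2 : ∫ t : Torus, ‖f t‖ ^ 2 ∂AddCircle.haarAddCircle = ‖f‖ ^ 2 := by
    have h3 := congr_arg RCLike.re (@L2.inner_def Torus ℂ ℂ _ _ _ _ _ f f)
    rw [← integral_re] at h3
    · simp only [← norm_sq_eq_re_inner] at h3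
      exact h3.symm
    · exact L2.integrable_inner f f
  rwa [h2] at h

theorem exists_fourierCoeff_eq {a : ℤ → ℂ} (ha : Summable fun n => ‖a n‖ ^ 2) :
    ∃ f : L2T, ∀ n, fourierCoeff f n = a n := by
  have hm : Memℓp a 2 := by
    apply memℓp_gen
    simpa using ha
  refine ⟨(fourierBasis (T := 2 * Real.pi)).repr.symm ⟨a, hm⟩, fun n => ?_⟩
  rw [← fourierBasis_repr, LinearIsometryEquiv.apply_symm_apply]

/-- Parseval turns the squared distance into a series over frequencies, to which dominated
convergence applies. -/
theorem tendsto_of_fourierCoeff {α : Type*} {l : Filter α} {u : α → L2T} {f : L2T} {b : ℤ → ℝ}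
    (hb : Summable b) (h : ∀ n, Tendsto (fun a => fourierCoeff (u a) n) l (𝓝 (fourierCoeff f n)))
    (hbound : ∀ᶠ a in l, ∀ n, ‖fourierCoeff (u a) n - fourierCoeff f n‖ ^ 2 ≤ b n) :
    Tendsto u l (𝓝 f) := by
  have key : Tendsto (fun a => ∑' n : ℤ, ‖fourierCoeff (u a) n - fourierCoeff f n‖ ^ 2) l
      (𝓝 (∑' _ : ℤ, (0 : ℝ))) := by
    refine tendsto_tsum_of_dominated_convergence hb (fun n => ?_) ?_
    · have h1 := ((h n).sub_const (fourierCoeff f n)).norm.pow 2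
      simpa using h1
    · filter_upwards [hbound] with a ha n
      rw [Real.norm_of_nonneg (by positivity)]
      exact ha n
  have e : ∀ a, ∑' n : ℤ, ‖fourierCoeff (u a) n - fourierCoeff f n‖ ^ 2 = ‖u a - f‖ ^ 2 := by
    intro a
    rw [← (hasSum_sq_fourierCoeff_L2T (u a - f)).tsum_eq]
    congr 1
    ext n
    rw [← fourierCoeffCLM_apply, ← fourierCoeffCLM_apply, ← fourierCoeffCLM_apply, map_sub]
  simp only [e, tsum_zero] at key
  rw [tendsto_iff_norm_sub_tendsto_zero]
  have h2 := key.sqrt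
  simpa [Real.sqrt_sq] using h2

theorem continuous_of_continuous_coe {φ : Torus → ℂ} (h : Continuous fun x : ℝ => φ (x : Torus)) :
    Continuous φ :=
  (QuotientAddGroup.isQuotientMap_mk (N := AddSubgroup.zmultiples (2 * Real.pi))).continuous_iff.2 h

/-- The integral over the torus of a continuous derivative vanishes. -/
theorem integral_deriv_eq_zero {χ χ' : Torus → ℂ} (hc : Continuous χ')
    (h : ∀ x : ℝ, HasDerivAt (fun y : ℝ => χ (y : Torus)) (χ' (x : Torus)) x) :
    ∫ x, χ' x ∂AddCircle.haarAddCircle = 0 := by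
  rw [AddCircle.integral_haarAddCircle, ← AddCircle.intervalIntegral_preimage (2 * Real.pi) 0,
    intervalIntegral.integral_eq_sub_of_hasDerivAt (fun x _ => h x)]
  · have : ((0 + 2 * Real.pi : ℝ) : Torus) = ((0 : ℝ) : Torus) := by
      rw [zero_add]; exact AddCircle.coe_period _
    rw [this, sub_self, smul_zero]
  · exact (hc.comp (AddCircle.continuous_mk' _)).intervalIntegrable _ _

theorem integral_fourier_mul_deriv {φ ψ : Torus → ℂ} (hφ : Continuous φ) (hψ : Continuous ψ)
    (h : ∀ x : ℝ, HasDerivAt (fun y : ℝ => φ (y : Torus)) (ψ (x : Torus)) x) (n : ℤ) :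
    ∫ x, fourier n x * ψ x ∂AddCircle.haarAddCircle
      = -(Complex.I * n * ∫ x, fourier n x * φ x ∂AddCircle.haarAddCircle) := by
  have hd : ∀ x : ℝ, HasDerivAt (fun y : ℝ => (fourier n (y : Torus) : ℂ))
      (Complex.I * n * fourier n (x : Torus)) x := by
    intro x
    convert hasDerivAt_fourier (2 * Real.pi) n x using 1
    have hpi : (Real.pi : ℂ) ≠ 0 := by exact_mod_cast Real.pi_ne_zero
    push_cast
    field_simp
  have hf : Continuous (fourier n : Torus → ℂ) := (fourier n).continuous
  have hint : ∀ {u : Torus → ℂ}, Continuous u → Integrable u AddCircle.haarAddCircle := fun hu =>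
    hu.integrable_of_hasCompactSupport (HasCompactSupport.of_compactSpace _)
  have key := integral_deriv_eq_zero (χ := fun x => fourier n x * φ x)
    (χ' := fun x => Complex.I * n * (fourier n x * φ x) + fourier n x * ψ x)
    (by fun_prop) (fun x => ((hd x).mul (h x)).congr_deriv (by ring))
  rw [integral_add (hint (by fun_prop)) (hint (by fun_prop)), integral_const_mul] at key
  linear_combination key

/-- For the converse, Parseval expands both pairings with the test function, and integration by
parts against each exponential matches the two series term by term. -/
theorem isWeakDeriv_iff {f g : L2T} :
    IsWeakDeriv f g ↔ ∀ n : ℤ, fourierCoeff g n = Complex.I * n * fourierCoeff f n := by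
  refine ⟨fun h n => h.fourierCoeff_eq n, fun h φ ψ hφs hφ => ?_⟩
  have hφc : Continuous φ := continuous_of_continuous_coe hφs.continuous
  have hψc : Continuous ψ := by
    apply continuous_of_continuous_coe
    have e : (fun x : ℝ => ψ (x : Torus)) = deriv fun y : ℝ => φ (y : Torus) := by
      ext x; exact (hφ x).deriv.symm
    rw [e]
    exact hφs.continuous_deriv (by simp)
  -- Parseval's identity for the bilinear pairing with a continuous function
  have pars : ∀ {u : Torus → ℂ}, Continuous u → ∀ q : L2T,
      HasSum (fun n : ℤ => (∫ x, fourier n x * u x ∂AddCircle.haarAddCircle) * fourierCoeff q n)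
        (∫ x, q x * u x ∂AddCircle.haarAddCircle) := by
    intro u hu q
    let v : C(Torus, ℂ) := ⟨fun x => star (u x), by fun_prop⟩
    let V : L2T := ContinuousMap.toLp 2 AddCircle.haarAddCircle ℂ v
    have hV : V =ᵐ[AddCircle.haarAddCircle] v := ContinuousMap.coeFn_toLp _ _
    have hin : ∀ q : L2T, inner ℂ V q = ∫ x, q x * u x ∂AddCircle.haarAddCircle := by
      intro q
      rw [L2.inner_def]
      apply integral_congr_ae
      filter_upwards [hV] with x hx
      rw [hx]
      simp [v]
    have hs := (fourierBasis (T := 2 * Real.pi)).hasSum_inner_mul_inner V q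
    rw [hin] at hs
    refine Eq.mpr (congrArg (fun w => HasSum w _) (funext fun n => ?_)) hs
    rw [← HilbertBasis.repr_apply_apply, fourierBasis_repr, hin]
    congr 1
    apply integral_congr_ae
    rw [coe_fourierBasis]
    filter_upwards [coeFn_fourierLp (T := 2 * Real.pi) 2 n] with x hx
    rw [hx]
  have h1 := pars hψc f
  have h2 := (pars hφc g).neg
  refine h1.unique ?_
  refine Eq.mpr (congrArg (fun w => HasSum w _) (funext fun n => ?_)) h2
  rw [integral_fourier_mul_deriv hφc hψc hφ, h n]
  ring

theorem memH_iff (k : ℕ) (f : L2T) :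
    MemH k f ↔ Summable fun n : ℤ => (|(n : ℝ)| ^ k * ‖fourierCoeff f n‖) ^ 2 := by
  induction k generalizing f with
  | zero => simpa [MemH] using (hasSum_sq_fourierCoeff_L2T f).summable
  | succ k ih =>
    have hnorm : ∀ n : ℤ, ‖(n : ℂ)‖ = |(n : ℝ)| := fun n => by
      rw [Complex.norm_intCast]
    constructor
    · rintro ⟨g, hg, hk⟩
      refine ((ih g).1 hk).congr fun n => ?_
      rw [hg.fourierCoeff_eq n]
      simp only [norm_mul, Complex.norm_I, one_mul, hnorm]
      ring
    · intro h
      have hs : Summable fun n : ℤ => ‖Complex.I * n * fourierCoeff f n‖ ^ 2 := by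
        refine h.of_nonneg_of_le (fun n => by positivity) fun n => ?_
        simp only [norm_mul, Complex.norm_I, one_mul, hnorm]
        rcases eq_or_ne n 0 with rfl | hn
        · simp
        · have h1 : (1 : ℝ) ≤ |(n : ℝ)| := by
            rw [← Int.cast_abs]; exact_mod_cast Int.one_le_abs hn
          have h2 : |(n : ℝ)| ≤ |(n : ℝ)| ^ (k + 1) := by
            simpa using pow_le_pow_right₀ h1 (Nat.le_add_left 1 k)
          gcongr
      obtain ⟨g, hg⟩ := exists_fourierCoeff_eq hs
      refine ⟨g, isWeakDeriv_iff.2 hg, (ih g).2 (h.congr fun n => ?_)⟩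
      rw [hg n]
      simp only [norm_mul, Complex.norm_I, one_mul, hnorm]
      ring

theorem MemH.fourierCoeff_weakDeriv {k : ℕ} {f : L2T} (h : MemH (k + 1) f) (n : ℤ) :
    fourierCoeff (weakDeriv f) n = Complex.I * n * fourierCoeff f n := by
  obtain ⟨g, hg, -⟩ := h
  rw [hg.weakDeriv_eq, hg.fourierCoeff_eq]

theorem MemH.weakDeriv {k : ℕ} {f : L2T} (h : MemH (k + 1) f) : MemH k (weakDeriv f) := by
  obtain ⟨g, hg, hk⟩ := h
  rwa [hg.weakDeriv_eq]

/-! ### Fourier coefficients of vector-valued functions -/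

variable {ι : Type*}

/-- The `n`-th Fourier coefficient of an element of `L²(𝕋)^ι`. -/
def coeff (n : ℤ) : (ι → L2T) →L[ℂ] (ι → ℂ) :=
  ContinuousLinearMap.pi fun i => (fourierCoeffCLM n).comp (ContinuousLinearMap.proj i)

theorem coeff_apply (n : ℤ) (f : ι → L2T) (i : ι) : coeff n f i = fourierCoeff (f i) n :=
  fourierCoeffCLM_apply n (f i)

theorem ext_coeff {f g : ι → L2T} (h : ∀ n, coeff n f = coeff n g) : f = g := by
  funext i
  refine ext_fourierCoeff fun n => ?_
  rw [← coeff_apply, ← coeff_apply, h]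

variable [Fintype ι]

theorem sq_norm_le_sum (x : ι → ℂ) : ‖x‖ ^ 2 ≤ ∑ i, ‖x i‖ ^ 2 := by
  have h0 : 0 ≤ ∑ i, ‖x i‖ ^ 2 := by positivity
  refine Real.le_sqrt (norm_nonneg _) h0 |>.1 ((pi_norm_le_iff_of_nonneg (Real.sqrt_nonneg _)).2 ?_)
  intro i
  refine Real.le_sqrt_of_sq_le ?_
  exact Finset.single_le_sum (f := fun i => ‖x i‖ ^ 2) (fun i _ => by positivity)
    (Finset.mem_univ i)

theorem summable_sq_mul_norm {w : ℤ → ℝ} {x : ℤ → ι → ℂ}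
    (h : ∀ i, Summable fun n => (w n * ‖x n i‖) ^ 2) : Summable fun n => (w n * ‖x n‖) ^ 2 := by
  refine (summable_sum (s := Finset.univ) fun i _ => h i).of_nonneg_of_le
    (fun n => by positivity) fun n => ?_
  simp only [mul_pow, ← Finset.mul_sum]
  gcongr
  exact sq_norm_le_sum _

theorem summable_sq_coeff (f : ι → L2T) : Summable fun n => ‖coeff n f‖ ^ 2 := by
  have h := summable_sq_mul_norm (w := fun _ => 1) (x := fun n => coeff n f) fun i => by
    simpa only [one_mul, coeff_apply] using (hasSum_sq_fourierCoeff_L2T (f i)).summable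
  simpa only [one_mul] using h

theorem exists_coeff_eq {x : ℤ → ι → ℂ} (hx : Summable fun n => ‖x n‖ ^ 2) :
    ∃ f : ι → L2T, ∀ n, coeff n f = x n := by
  have h : ∀ i, ∃ f : L2T, ∀ n, fourierCoeff f n = x n i := fun i =>
    exists_fourierCoeff_eq <| hx.of_nonneg_of_le (fun n => by positivity) fun n => by
      gcongr
      exact norm_le_pi_norm (x n) i
  choose f hf using h
  exact ⟨f, fun n => funext fun i => by rw [coeff_apply, hf]⟩

theorem tendsto_of_coeff {α : Type*} {l : Filter α} {u : α → ι → L2T} {f : ι → L2T} {b : ℤ → ℝ}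
    (hb : Summable b) (h : ∀ n, Tendsto (fun a => coeff n (u a)) l (𝓝 (coeff n f)))
    (hbound : ∀ᶠ a in l, ∀ n, ‖coeff n (u a) - coeff n f‖ ^ 2 ≤ b n) : Tendsto u l (𝓝 f) := by
  refine tendsto_pi_nhds.2 fun i => tendsto_of_fourierCoeff hb (fun n => ?_) ?_
  · simpa only [coeff_apply] using tendsto_pi_nhds.1 (h n) i
  · filter_upwards [hbound] with a ha n
    refine le_trans ?_ (ha n)
    gcongr
    simpa only [Pi.sub_apply, coeff_apply] using norm_le_pi_norm (coeff n (u a) - coeff n f) i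

/-- A uniformly bounded sequence of matrices is the symbol of a bounded Fourier multiplier. -/
theorem exists_multiplier (m : ℤ → (ι → ℂ) →L[ℂ] (ι → ℂ)) {C : ℝ} (hm : ∀ n, ‖m n‖ ≤ C) :
    ∃ T : (ι → L2T) →L[ℂ] (ι → L2T), ∀ n f, coeff n (T f) = m n (coeff n f) := by
  have hle : ∀ n x, ‖m n x‖ ≤ C * ‖x‖ := fun n x => (m n).le_of_opNorm_le (hm n) x
  have h : ∀ f : ι → L2T, ∃ g : ι → L2T, ∀ n, coeff n g = m n (coeff n f) := fun f => by
    refine exists_coeff_eq (((summable_sq_coeff f).mul_left (C ^ 2)).of_nonneg_of_le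
      (fun n => by positivity) fun n => ?_)
    rw [← mul_pow]
    gcongr
    exact hle n _
  choose T hT using h
  let L : (ι → L2T) →ₗ[ℂ] (ι → L2T) :=
    { toFun := T
      map_add' := fun f g => ext_coeff fun n => by simp only [hT, map_add]
      map_smul' := fun c f => ext_coeff fun n => by simp only [hT, map_smul, RingHom.id_apply] }
  -- Continuity comes from the closed graph theorem: coefficients are continuous and determine the
  -- function.
  refine ⟨⟨L, L.continuous_of_seq_closed_graph fun u x y hu hy => ext_coeff fun n => ?_⟩,
    fun n f => hT f n⟩
  have h1 := ((coeff n).continuous.tendsto y).comp hy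
  have h2 := ((m n).continuous.tendsto _).comp (((coeff n).continuous.tendsto x).comp hu)
  refine tendsto_nhds_unique h1 (h2.congr fun k => ?_) |>.trans (hT x n).symm
  exact (hT (u k) n).symm

/-! ### Differential inequalities for the norms of two coupled curves -/

theorem le_gronwallBound_of_hasDerivAt {u u' : ℝ → ℝ} {κ ε T : ℝ}
    (hu : ∀ t, HasDerivAt u (u' t) t) (hb : ∀ t ∈ Set.Icc 0 T, u' t ≤ κ * u t + ε) :
    ∀ t ∈ Set.Icc 0 T, u t ≤ gronwallBound (u 0) κ ε t := by
  intro t ht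
  have h := le_gronwallBound_of_liminf_deriv_right_le (f := u) (f' := u') (δ := u 0) (K := κ)
    (ε := ε) (a := 0) (b := T) (fun x _ => (hu x).continuousAt.continuousWithinAt)
    (fun x _ r hr => (hu x).hasDerivWithinAt.liminf_right_slope_le hr) le_rfl
    (fun x hx => hb x (Set.Ico_subset_Icc_self hx)) t ht
  rwa [sub_zero] at h

variable {E F : Type*} [NormedAddCommGroup E] [NormedAddCommGroup F]

/-- A smooth regularization of the norm. -/
def regNorm (ε : ℝ) (v : E) : ℝ := √(‖v‖ ^ 2 + ε ^ 2)

theorem sq_regNorm (ε : ℝ) (v : E) : regNorm ε v ^ 2 = ‖v‖ ^ 2 + ε ^ 2 :=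
  Real.sq_sqrt (by positivity)

theorem norm_le_regNorm (ε : ℝ) (v : E) : ‖v‖ ≤ regNorm ε v :=
  Real.le_sqrt_of_sq_le (by nlinarith [sq_nonneg ε])

theorem le_regNorm (ε : ℝ) (v : E) : ε ≤ regNorm ε v :=
  Real.le_sqrt_of_sq_le (by nlinarith [sq_nonneg ‖v‖])

theorem regNorm_le {ε : ℝ} (hε : 0 ≤ ε) (v : E) : regNorm ε v ≤ ‖v‖ + ε :=
  Real.sqrt_le_iff.2 ⟨by positivity, by nlinarith [mul_nonneg (norm_nonneg v) hε]⟩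

variable [InnerProductSpace ℂ E] [InnerProductSpace ℂ F]

theorem hasDerivAt_regNorm {ε : ℝ} (hε : 0 < ε) {p : ℝ → E} {p' : E} {t : ℝ}
    (hp : HasDerivAt p p' t) :
    HasDerivAt (fun s => regNorm ε (p s)) ((inner ℂ (p t) p').re / regNorm ε (p t)) t := by
  have h1 := hp.inner ℂ hp
  have h2 : HasDerivAt (fun s => ‖p s‖ ^ 2) (2 * (inner ℂ (p t) p').re) t := by
    have h3 := Complex.reCLM.hasFDerivAt.comp_hasDerivAt t h1
    have e : (Complex.reCLM ∘ fun s => inner ℂ (p s) (p s)) = fun s => ‖p s‖ ^ 2 := by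
      ext s
      exact inner_self_eq_norm_sq (𝕜 := ℂ) (p s)
    rw [e] at h3
    refine h3.congr_deriv ?_
    rw [Complex.reCLM_apply, Complex.add_re, ← inner_conj_symm p' (p t), Complex.conj_re]
    ring
  refine ((h2.add_const (ε ^ 2)).sqrt (by positivity)).congr_deriv ?_
  exact mul_div_mul_left _ _ two_ne_zero

/-- The norm is not differentiable at zero. Passing to its regularization keeps the rate `-a`, of
either sign, and costs only an error `|a| * ε`. -/
theorem re_inner_div_regNorm_le {ε a g : ℝ} (hε : 0 < ε) (hg : 0 ≤ g) {v w : E}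
    (h : (inner ℂ v w).re ≤ ‖v‖ * (-a * ‖v‖ + g)) :
    (inner ℂ v w).re / regNorm ε v ≤ -a * regNorm ε v + (|a| * ε + g) := by
  have h0 : ε ≤ regNorm ε v := le_regNorm ε v
  rw [div_le_iff₀ (hε.trans_le h0)]
  have h1 := sq_regNorm ε v
  have h2 := norm_le_regNorm ε v
  have h3 : a * ε ^ 2 ≤ |a| * ε * regNorm ε v := by
    calc a * ε ^ 2 ≤ |a| * ε ^ 2 := by gcongr; exact le_abs_self a
      _ = |a| * ε * ε := by ring
      _ ≤ _ := by gcongr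
  have h4 : a * regNorm ε v ^ 2 = a * ‖v‖ ^ 2 + a * ε ^ 2 := by rw [h1, mul_add]
  nlinarith [mul_le_mul_of_nonneg_left h2 hg]

theorem norm_le_of_re_inner_le {p p' : ℝ → E} {a g T : ℝ} (ha : 0 < a) (hg : 0 ≤ g)
    (hp : ∀ t, HasDerivAt p (p' t) t)
    (hb : ∀ t ∈ Set.Icc 0 T, (inner ℂ (p t) (p' t)).re ≤ ‖p t‖ * (-a * ‖p t‖ + g)) :
    ∀ t ∈ Set.Icc 0 T, ‖p t‖ ≤ Real.exp (-a * t) * ‖p 0‖ + g / a := by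
  intro t ht
  refine le_of_forall_pos_le_add fun δ hδ => ?_
  have hε : 0 < δ / 2 := by positivity
  have h := le_gronwallBound_of_hasDerivAt (fun s => hasDerivAt_regNorm hε (hp s))
    (fun s hs => re_inner_div_regNorm_le hε hg (hb s hs)) t ht
  rw [gronwallBound_of_K_ne_0 (by linarith : -a ≠ 0), abs_of_pos ha] at h
  have h1 := norm_le_regNorm (δ / 2) (p t)
  have h2 := regNorm_le hε.le (p 0)
  have h3 : Real.exp (-a * t) ≤ 1 := Real.exp_le_one_iff.2 (by nlinarith [ht.1])
  have h4 := Real.exp_pos (-a * t)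
  have h5 : (a * (δ / 2) + g) / -a * (Real.exp (-a * t) - 1)
      = (δ / 2 + g / a) * (1 - Real.exp (-a * t)) := by field_simp; ring
  beta_reduce at h
  rw [h5] at h
  have h6 : 0 ≤ g / a := by positivity
  nlinarith [mul_le_mul_of_nonneg_right h2 h4.le, mul_nonneg h6 h4.le]

/-- Grönwall for the weighted sum of norms: `hbw` lets the damping of `p` absorb its forcing of `h`,
and `hew` pays for the forcing of `p` by `h` with the growth rate `κ`. -/
theorem norm_add_mul_norm_le {h h' : ℝ → E} {p p' : ℝ → F} {C a b e w κ T : ℝ} (hC : 0 ≤ C)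
    (ha : 0 ≤ a) (hb : 0 ≤ b) (he : 0 ≤ e) (hw : 0 ≤ w) (hκ : 0 < κ) (hbw : b ≤ w * a)
    (hew : C + w * e ≤ κ) (hh : ∀ t, HasDerivAt h (h' t) t) (hp : ∀ t, HasDerivAt p (p' t) t)
    (hh' : ∀ t ∈ Set.Icc 0 T, (inner ℂ (h t) (h' t)).re ≤ ‖h t‖ * (C * ‖h t‖ + b * ‖p t‖))
    (hp' : ∀ t ∈ Set.Icc 0 T, (inner ℂ (p t) (p' t)).re ≤ ‖p t‖ * (-a * ‖p t‖ + e * ‖h t‖)) :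
    ∀ t ∈ Set.Icc 0 T, ‖h t‖ + w * ‖p t‖ ≤ (‖h 0‖ + w * ‖p 0‖) * Real.exp (κ * t) := by
  intro t ht
  have key : ∀ ε : ℝ, 0 < ε → ‖h t‖ + w * ‖p t‖ ≤
      (‖h 0‖ + ε + w * (‖p 0‖ + ε)) * Real.exp (κ * t)
        + (C * ε + w * (a * ε)) / κ * (Real.exp (κ * t) - 1) := by
    intro ε hε
    have hV : ∀ s, HasDerivAt (fun s => regNorm ε (h s) + w * regNorm ε (p s))
        ((inner ℂ (h s) (h' s)).re / regNorm ε (h s)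
          + w * ((inner ℂ (p s) (p' s)).re / regNorm ε (p s))) s := fun s =>
      (hasDerivAt_regNorm hε (hh s)).add ((hasDerivAt_regNorm hε (hp s)).const_mul w)
    have hbd : ∀ s ∈ Set.Icc 0 T, (inner ℂ (h s) (h' s)).re / regNorm ε (h s)
          + w * ((inner ℂ (p s) (p' s)).re / regNorm ε (p s))
        ≤ κ * (regNorm ε (h s) + w * regNorm ε (p s)) + (C * ε + w * (a * ε)) := by
      intro s hs
      have h1 := re_inner_div_regNorm_le (a := -C) (g := b * ‖p s‖) hε (by positivity)
        (by rw [neg_neg]; exact hh' s hs)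
      have h2 := re_inner_div_regNorm_le hε (by positivity) (hp' s hs)
      rw [abs_neg, abs_of_nonneg hC, neg_neg] at h1
      rw [abs_of_nonneg ha] at h2
      have h3 := norm_le_regNorm ε (h s)
      have h4 := norm_le_regNorm ε (p s)
      have h5 : 0 ≤ regNorm ε (h s) := (norm_nonneg _).trans h3
      have h6 : 0 ≤ regNorm ε (p s) := (norm_nonneg _).trans h4
      have h7 := mul_le_mul_of_nonneg_left h2 hw
      have h8 : b * ‖p s‖ ≤ w * a * regNorm ε (p s) := by gcongr
      have h9 : w * e * ‖h s‖ ≤ w * e * regNorm ε (h s) := by gcongr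
      have h10 := mul_le_mul_of_nonneg_right hew h5
      have h11 : 0 ≤ κ * (w * regNorm ε (p s)) := by positivity
      nlinarith
    have h1 := le_gronwallBound_of_hasDerivAt hV hbd t ht
    rw [gronwallBound_of_K_ne_0 hκ.ne'] at h1
    beta_reduce at h1
    have h2 : regNorm ε (h 0) + w * regNorm ε (p 0) ≤ ‖h 0‖ + ε + w * (‖p 0‖ + ε) := by
      gcongr
      · exact regNorm_le hε.le _
      · exact regNorm_le hε.le _
    calc ‖h t‖ + w * ‖p t‖ ≤ regNorm ε (h t) + w * regNorm ε (p t) := by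
          gcongr
          · exact norm_le_regNorm _ _
          · exact norm_le_regNorm _ _
      _ ≤ _ := h1
      _ ≤ _ := by gcongr
  have hlim : Tendsto (fun ε : ℝ => (‖h 0‖ + ε + w * (‖p 0‖ + ε)) * Real.exp (κ * t)
        + (C * ε + w * (a * ε)) / κ * (Real.exp (κ * t) - 1)) (𝓝[>] 0)
      (𝓝 ((‖h 0‖ + 0 + w * (‖p 0‖ + 0)) * Real.exp (κ * t)
        + (C * 0 + w * (a * 0)) / κ * (Real.exp (κ * t) - 1))) := by
    apply tendsto_nhdsWithin_of_tendsto_nhds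
    refine Continuous.tendsto (f := fun ε : ℝ => (‖h 0‖ + ε + w * (‖p 0‖ + ε)) * Real.exp (κ * t)
        + (C * ε + w * (a * ε)) / κ * (Real.exp (κ * t) - 1)) ?_ 0
    fun_prop
  have := ge_of_tendsto hlim (by filter_upwards [self_mem_nhdsWithin] with ε hε using key ε hε)
  simpa using this

/-- A transported curve `h` coupled to a strongly damped curve `p`: the two estimates which are
uniform in the frequency `r`. The exponent `k` measures the gain of the transported part over the
damped one. -/
theorem exists_transport_damping_estimate {C c T : ℝ} (hC : 0 < C) (hc : 0 < c) :
    ∃ M : ℝ, 0 ≤ M ∧ ∀ {r : ℝ} {k : ℕ} {h h' : ℝ → E} {p p' : ℝ → F}, 1 ≤ r → 1 ≤ k →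
      (∀ t, HasDerivAt h (h' t) t) → (∀ t, HasDerivAt p (p' t) t) →
      (∀ t, (inner ℂ (h t) (h' t)).re ≤ ‖h t‖ * (C * ‖h t‖ + C * r ^ 2 / r ^ k * ‖p t‖)) →
      (∀ t, (inner ℂ (p t) (p' t)).re ≤ ‖p t‖ * (-(c * r ^ 2) * ‖p t‖ + C * r * ‖h t‖)) →
      ∀ t ∈ Set.Icc 0 T, ‖h t‖ ≤ M * (‖h 0‖ + ‖p 0‖ / r ^ k) ∧
        ‖p t‖ ≤ Real.exp (-(c * r ^ 2) * t) * ‖p 0‖ + M * (‖h 0‖ + ‖p 0‖ / r ^ k) / r := by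
  -- The weight will be `w = C / c / r ^ k`, for which the damping `w * (c * r ^ 2)` exactly
  -- balances the forcing of `h`. The reverse forcing then costs `w * (C * r) ≤ C / c * C`, so `κ`
  -- does not depend on `r`.
  set κ := C + C / c * C
  have hκ : 0 < κ := by positivity
  set M₀ := (1 + C / c) * Real.exp (κ * T)
  have hM₀ : 0 ≤ M₀ := by positivity
  have hCc : 0 < C / c := by positivity
  refine ⟨(1 + C / c) * M₀, by positivity, ?_⟩
  intro r k h h' p p' hr hk hh hp hh' hp' t ht
  have hr0 : 0 < r := by linarith
  have hrk : r ≤ r ^ k := by simpa using pow_le_pow_right₀ hr hk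
  have hH : ∀ s ∈ Set.Icc 0 T, ‖h s‖ ≤ M₀ * (‖h 0‖ + ‖p 0‖ / r ^ k) := by
    intro s hs
    have h1 := norm_add_mul_norm_le (T := T) (w := C / c / r ^ k) (κ := κ) hC.le
      (by positivity : 0 ≤ c * r ^ 2) (by positivity : 0 ≤ C * r ^ 2 / r ^ k)
      (by positivity : 0 ≤ C * r) (by positivity) hκ (le_of_eq (by field_simp))
      (by
        have : C / c / r ^ k * (C * r) = C / c * C * (r / r ^ k) := by field_simp
        rw [this]
        have h2 : r / r ^ k ≤ 1 := (div_le_one₀ (by positivity)).2 hrk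
        have h3 : C / c * C * (r / r ^ k) ≤ C / c * C * 1 := by gcongr
        simp only [κ]
        linarith)
      hh hp (fun t _ => hh' t) (fun t _ => hp' t) s hs
    calc ‖h s‖ ≤ ‖h s‖ + C / c / r ^ k * ‖p s‖ := by
          have : 0 ≤ C / c / r ^ k * ‖p s‖ := by positivity
          linarith
      _ ≤ _ := h1
      _ ≤ (‖h 0‖ + C / c / r ^ k * ‖p 0‖) * Real.exp (κ * T) := by
          gcongr
          exact hs.2
      _ ≤ ((1 + C / c) * (‖h 0‖ + ‖p 0‖ / r ^ k)) * Real.exp (κ * T) := by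
          gcongr
          have e : C / c / r ^ k * ‖p 0‖ = C / c * (‖p 0‖ / r ^ k) := by ring
          have h2 : 0 ≤ ‖p 0‖ / r ^ k := by positivity
          rw [e]
          nlinarith [norm_nonneg (h 0), mul_nonneg hCc.le (norm_nonneg (h 0))]
      _ = _ := by simp only [M₀]; ring
  set H := M₀ * (‖h 0‖ + ‖p 0‖ / r ^ k)
  have hH0 : 0 ≤ H := by positivity
  have eM : (1 + C / c) * M₀ * (‖h 0‖ + ‖p 0‖ / r ^ k) = (1 + C / c) * H := by
    simp only [H]; ring
  rw [eM]
  refine ⟨(hH t ht).trans (by nlinarith), ?_⟩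
  -- With `h` already bounded by `H`, the curve `p` has constant forcing `C * r * H` against damping
  -- `c * r ^ 2`; their quotient supplies the factor `1 / r`.
  have h2 := norm_le_of_re_inner_le (T := T) (g := C * r * H) (by positivity : 0 < c * r ^ 2)
    (by positivity) hp (fun s hs => (hp' s).trans (by
      gcongr
      exact hH s hs)) t ht
  have e : C * r * H / (c * r ^ 2) = C / c * H / r := by field_simp
  rw [e] at h2
  refine h2.trans ?_
  gcongr
  linarith

/-! ### An adapted inner product for a stable endomorphism -/

/-- An endomorphism of a finite-dimensional complex space whose eigenvalues all have positive real
part is strictly accretive for a suitable inner product. -/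
theorem exists_accretive_embedding (m : ℕ) (V : Type) [AddCommGroup V] [Module ℂ V]
    [FiniteDimensional ℂ V] (hm : Module.finrank ℂ V = m) (D : Module.End ℂ V)
    (hD : ∀ μ, D.HasEigenvalue μ → 0 < μ.re) :
    ∃ (F : Type) (_ : NormedAddCommGroup F) (_ : InnerProductSpace ℂ F) (e : V →ₗ[ℂ] F) (c : ℝ),
      Function.Injective e ∧ 0 < c ∧ ∀ x, c * ‖e x‖ ^ 2 ≤ (inner ℂ (e x) (e (D x))).re := by
  induction m generalizing V with
  | zero =>
    have hs : Subsingleton V := Module.finrank_zero_iff.1 hm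
    refine ⟨ℂ, inferInstance, inferInstance, 0, 1, fun x y _ => Subsingleton.elim x y, one_pos, ?_⟩
    simp
  | succ m ih =>
    have hnt : Nontrivial V := Module.nontrivial_of_finrank_pos (R := ℂ) (by omega)
    -- An eigenvector `f` of the transpose has a `D`-invariant kernel of codimension one, to which
    -- the induction hypothesis applies.
    obtain ⟨μ, hμ⟩ := Module.End.exists_eigenvalue (D.dualMap : Module.End ℂ (Module.Dual ℂ V))
    obtain ⟨f, hf⟩ := hμ.exists_hasEigenvector
    have hfD : ∀ x, f (D x) = μ * f x := fun x => by
      have := LinearMap.congr_fun hf.apply_eq_smul x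
      simpa using this
    have hf0 : f ≠ 0 := hf.2
    obtain ⟨v, hv⟩ : ∃ v, f v = 1 := LinearMap.surjective hf0 1
    have hμre : 0 < μ.re := by
      apply hD
      rw [Module.End.hasEigenvalue_iff_mem_spectrum, spectrum.mem_iff]
      -- If `μ - D` were onto, `v` would lie in its range, on which `f` vanishes, contradicting `f v
      -- = 1`.
      intro hu
      rw [Module.End.isUnit_iff] at hu
      obtain ⟨y, hy⟩ := hu.2 v
      have h1 := congr_arg f hy
      rw [LinearMap.sub_apply, Module.algebraMap_end_apply, map_sub, map_smul, hfD, hv] at h1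
      simp at h1
    have hmaps : ∀ x ∈ LinearMap.ker f, D x ∈ LinearMap.ker f := fun x hx => by
      rw [LinearMap.mem_ker] at hx ⊢
      rw [hfD, hx, mul_zero]
    have hrank : Module.finrank ℂ (LinearMap.ker f) = m := by
      have h1 := LinearMap.finrank_range_add_finrank_ker f
      rw [LinearMap.range_eq_top.2 (LinearMap.surjective hf0), finrank_top,
        Module.finrank_self, hm] at h1
      omega
    obtain ⟨F, iF, iF', e, c, he, hc, hec⟩ := ih (LinearMap.ker f) hrank (D.restrict hmaps) (by
      intro ν hν
      obtain ⟨x, hx⟩ := hν.exists_hasEigenvector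
      refine hD ν (Module.End.hasEigenvalue_of_hasEigenvector (x := (x : V)) ⟨?_, ?_⟩)
      · rw [Module.End.mem_eigenspace_iff]
        exact congr_arg Subtype.val hx.apply_eq_smul
      · simpa using hx.2)
    let π : V →ₗ[ℂ] LinearMap.ker f :=
      (LinearMap.id - f.smulRight v).codRestrict _ fun x => by simp [hv]
    have hπ : ∀ x, ((π x : LinearMap.ker f) : V) = x - f x • v := fun x => rfl
    have hπD : ∀ x, π (D x) = D.restrict hmaps (π x) + f x • π (D v) := fun x => by
      apply Subtype.ext
      rw [Submodule.coe_add, Submodule.coe_smul, hπ, hπ, LinearMap.coe_restrict_apply, hπ, hfD, hfD,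
        hv, map_sub, map_smul, smul_sub, mul_one, smul_smul, mul_comm μ]
      abel
    set b := ‖e (π (D v))‖
    -- Relative to the splitting into `ker f` and the line of `v`, `D` is block triangular. Giving
    -- the `f`-coordinate a large weight `R` lets Young's inequality absorb the off-diagonal term
    -- into half of each diagonal one; the `+ 1` keeps `R` positive when `b = 0`.
    obtain ⟨R, hR, hR0⟩ : ∃ R : ℝ, b ^ 2 / (2 * c) ≤ R ^ 2 * μ.re / 2 ∧ 0 < R := by
      refine ⟨√(b ^ 2 / (c * μ.re) + 1), ?_, by positivity⟩
      rw [Real.sq_sqrt (by positivity)]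
      have e1 : (b ^ 2 / (c * μ.re) + 1) * μ.re / 2 = b ^ 2 / (2 * c) + μ.re / 2 := by
        field_simp
      rw [e1]
      linarith
    let e' : V →ₗ[ℂ] WithLp 2 (F × ℂ) :=
      (WithLp.linearEquiv 2 ℂ (F × ℂ)).symm.toLinearMap ∘ₗ
        LinearMap.prod (e ∘ₗ π) ((R : ℂ) • f)
    have he' : ∀ x, e' x = WithLp.toLp 2 (e (π x), (R : ℂ) * f x) := fun x => rfl
    refine ⟨WithLp 2 (F × ℂ), inferInstance, inferInstance, e', min (c / 2) (μ.re / 2), ?_,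
      by positivity, fun x => ?_⟩
    · rw [injective_iff_map_eq_zero]
      intro x hx
      rw [he'] at hx
      have h1 := congr_arg WithLp.fst hx
      have h2 := congr_arg WithLp.snd hx
      simp only [WithLp.zero_fst, WithLp.zero_snd] at h1 h2
      have h3 : f x = 0 := by simpa [hR0.ne'] using h2
      have h4 := hπ x
      rw [he (h1.trans (map_zero e).symm), h3] at h4
      simpa using h4.symm
    · have hn : ‖e' x‖ ^ 2 = ‖e (π x)‖ ^ 2 + R ^ 2 * ‖f x‖ ^ 2 := by
        rw [WithLp.prod_norm_sq_eq_of_L2, he']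
        simp [mul_pow]
      have hi : (inner ℂ (e' x) (e' (D x))).re = (inner ℂ (e (π x)) (e (D.restrict hmaps (π x)))).re
          + (f x * inner ℂ (e (π x)) (e (π (D v)))).re + R ^ 2 * μ.re * ‖f x‖ ^ 2 := by
        rw [WithLp.prod_inner_apply, he', he', hπD, hfD]
        simp only [map_add, map_smul, inner_add_right, inner_smul_right, Complex.add_re]
        congr 1
        rw [RCLike.inner_apply]
        have : (R : ℂ) * (μ * f x) * (starRingEnd ℂ) ((R : ℂ) * f x)
            = ((R ^ 2 * ‖f x‖ ^ 2 : ℝ) : ℂ) * μ := by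
          rw [map_mul, Complex.conj_ofReal]
          have := Complex.mul_conj' (f x)
          push_cast
          rw [← this]
          ring
        rw [this, Complex.re_ofReal_mul]
        ring
      have h1 := hec (π x)
      have h2 : -(‖f x‖ * (‖e (π x)‖ * b)) ≤ (f x * inner ℂ (e (π x)) (e (π (D v)))).re := by
        refine neg_le_of_abs_le ((Complex.abs_re_le_norm _).trans ?_)
        rw [norm_mul]
        gcongr
        exact norm_inner_le_norm _ _
      have h3 : ‖f x‖ * (‖e (π x)‖ * b)
          ≤ c / 2 * ‖e (π x)‖ ^ 2 + b ^ 2 / (2 * c) * ‖f x‖ ^ 2 := by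
        have : c / 2 * ‖e (π x)‖ ^ 2 + b ^ 2 / (2 * c) * ‖f x‖ ^ 2 - ‖f x‖ * (‖e (π x)‖ * b)
            = (c * ‖e (π x)‖ - b * ‖f x‖) ^ 2 / (2 * c) := by
          field_simp
          ring
        have h4 : 0 ≤ (c * ‖e (π x)‖ - b * ‖f x‖) ^ 2 / (2 * c) := by positivity
        linarith
      have h4 := mul_le_mul_of_nonneg_right hR (sq_nonneg ‖f x‖)
      have h5 : min (c / 2) (μ.re / 2) * ‖e (π x)‖ ^ 2 ≤ c / 2 * ‖e (π x)‖ ^ 2 := by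
        gcongr; exact min_le_left _ _
      have h6 : min (c / 2) (μ.re / 2) * (R ^ 2 * ‖f x‖ ^ 2) ≤ μ.re / 2 * (R ^ 2 * ‖f x‖ ^ 2) := by
        gcongr; exact min_le_right _ _
      rw [hn, hi]
      nlinarith

/-! ### The symbol of the operator -/

section Flow

variable {X : Type*} [NormedAddCommGroup X] [NormedSpace ℂ X]

/-- The symbol at frequency `n` of `B ∂ₓ² - A ∂ₓ - K`. -/
def symbol (A B K : X →L[ℂ] X) (n : ℤ) : X →L[ℂ] X :=
  -((n : ℂ) ^ 2 • B + (Complex.I * n) • A + K)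

theorem symbol_apply (A B K : X →L[ℂ] X) (n : ℤ) (x : X) :
    symbol A B K n x = -((n : ℂ) ^ 2 • B x + (Complex.I * n) • A x + K x) := rfl

variable {E F : Type*} [NormedAddCommGroup E] [InnerProductSpace ℂ E] [NormedAddCommGroup F]
  [InnerProductSpace ℂ F]

/-- A pair of maps to inner product spaces in which the transported and the damped part of the
system with coefficients `A`, `B` satisfy energy inequalities. -/
structure IsAdapted (A B : X →L[ℂ] X) (h : X →L[ℂ] E) (p : X →L[ℂ] F) (c β M : ℝ) : Prop where
  c_pos : 0 < c
  β_nonneg : 0 ≤ β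
  M_nonneg : 0 ≤ M
  h_B : ∀ x, h (B x) = 0
  p_B : ∀ x, c * ‖p x‖ ^ 2 ≤ (inner ℂ (p x) (p (B x))).re
  -- The transport term enters the energy of `h` as `n` times this imaginary part. The absence of a
  -- `‖h x‖ ^ 2` term says that the transport block is symmetric; `β` measures the coupling from the
  -- damped part.
  h_A : ∀ x, (|(inner ℂ (h x) (h (A x))).im| : ℝ) ≤ β * (‖h x‖ * ‖p x‖)
  norm_le : ∀ x, ‖x‖ ≤ M * (‖h x‖ + ‖p x‖)

variable {A B : X →L[ℂ] X} {h : X →L[ℂ] E} {p : X →L[ℂ] F} {c β M : ℝ}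

theorem IsAdapted.norm_apply_le (H : IsAdapted A B h p c β M) {G : Type*} [NormedAddCommGroup G]
    [NormedSpace ℂ G] (L : X →L[ℂ] G) (x : X) : ‖L x‖ ≤ ‖L‖ * M * (‖h x‖ + ‖p x‖) := by
  rw [mul_assoc]
  exact L.le_opNorm_of_le (H.norm_le x)

/-- In the damped part, `A` and `K` contribute at most `b * |n| * (‖h x‖ + ‖p x‖)` times `‖p x‖`.
Half of the damping `c * n ^ 2` pays for the `‖p x‖ ^ 2` term once `|n| ≥ 2 * b / c`, whence the
threshold and the rate `c / 2`. -/
theorem IsAdapted.exists_energy_le (H : IsAdapted A B h p c β M) (K : X →L[ℂ] X) {k : ℕ}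
    (hk : k = 1 ∨ k = 2 ∧ β = 0) :
    ∃ C N : ℝ, 0 < C ∧ 1 ≤ N ∧ ∀ n : ℤ, N ≤ |(n : ℝ)| → ∀ x,
      (inner ℂ (h x) (h (symbol A B K n x))).re
        ≤ ‖h x‖ * (C * ‖h x‖ + C * |(n : ℝ)| ^ 2 / |(n : ℝ)| ^ k * ‖p x‖) ∧
      (inner ℂ (p x) (p (symbol A B K n x))).re
        ≤ ‖p x‖ * (-(c / 2 * |(n : ℝ)| ^ 2) * ‖p x‖ + C * |(n : ℝ)| * ‖h x‖) := by
  have hM := H.M_nonneg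
  have hβ := H.β_nonneg
  have hc := H.c_pos
  set a := ‖h.comp K‖ * M
  set b := (‖p.comp A‖ + ‖p.comp K‖) * M
  have ha : 0 ≤ a := by positivity
  have hb : 0 ≤ b := by positivity
  refine ⟨a + b + β + 1, max 1 (2 * b / c), by positivity, le_max_left _ _, fun n hn x => ?_⟩
  have hn1 : 1 ≤ |(n : ℝ)| := (le_max_left _ _).trans hn
  have hn2 : 2 * b / c ≤ |(n : ℝ)| := (le_max_right _ _).trans hn
  have hn0 : 0 < |(n : ℝ)| := by linarith
  have hx0 := norm_nonneg (h x)
  have hp0 := norm_nonneg (p x)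
  constructor
  · have e1 : (inner ℂ (h x) (h (symbol A B K n x))).re
        = n * (inner ℂ (h x) (h (A x))).im - (inner ℂ (h x) (h (K x))).re := by
      rw [symbol_apply]
      simp only [map_neg, map_add, map_smul, H.h_B, smul_zero, zero_add, inner_neg_right,
        inner_add_right, inner_smul_right, Complex.neg_re, Complex.add_re]
      simp [Complex.mul_re]
      ring
    have e2 : n * (inner ℂ (h x) (h (A x))).im ≤ |(n : ℝ)| * (β * (‖h x‖ * ‖p x‖)) := by
      refine (le_abs_self _).trans ?_
      rw [abs_mul]
      gcongr
      exact H.h_A x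
    have e3 : -(inner ℂ (h x) (h (K x))).re ≤ ‖h x‖ * (a * (‖h x‖ + ‖p x‖)) := by
      refine (neg_le_abs _).trans ((Complex.abs_re_le_norm _).trans ?_)
      refine (norm_inner_le_norm _ _).trans ?_
      gcongr
      exact H.norm_apply_le (h.comp K) x
    -- The coupling into `h` is `O(|n|)` in general, but `O(1)` when `β = 0`, since only `K` then
    -- contributes; this is the source of the two values of `k`.
    have e4 : |(n : ℝ)| * β + a ≤ (a + b + β + 1) * |(n : ℝ)| ^ 2 / |(n : ℝ)| ^ k := by
      rcases hk with rfl | ⟨rfl, h0⟩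
      · rw [pow_one, pow_two, ← mul_assoc, mul_div_cancel_right₀ _ hn0.ne']
        nlinarith
      · rw [mul_div_cancel_right₀ _ (by positivity), h0]
        linarith
    have e5 := mul_le_mul_of_nonneg_right e4 hp0
    have e6 : (|(n : ℝ)| * β + a) * ‖p x‖ + a * ‖h x‖ ≤ (a + b + β + 1) * ‖h x‖
        + (a + b + β + 1) * |(n : ℝ)| ^ 2 / |(n : ℝ)| ^ k * ‖p x‖ := by
      have : a * ‖h x‖ ≤ (a + b + β + 1) * ‖h x‖ := by gcongr; linarith
      linarith
    have e7 := mul_le_mul_of_nonneg_left e6 hx0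
    rw [e1]
    nlinarith
  · have e1 : (inner ℂ (p x) (p (symbol A B K n x))).re
        = -(|(n : ℝ)| ^ 2 * (inner ℂ (p x) (p (B x))).re)
          + (-(inner ℂ (p x) ((Complex.I * n) • p (A x) + p (K x))).re) := by
      rw [symbol_apply]
      simp only [map_neg, map_add, map_smul, inner_neg_right,
        inner_add_right, inner_smul_right, Complex.neg_re, Complex.add_re]
      have : ((n : ℂ)) ^ 2 = ((|(n : ℝ)| ^ 2 : ℝ) : ℂ) := by rw [sq_abs]; push_cast; rfl
      rw [this, Complex.re_ofReal_mul]
      ring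
    have e2 : -(inner ℂ (p x) ((Complex.I * n) • p (A x) + p (K x))).re
        ≤ ‖p x‖ * (|(n : ℝ)| * b * (‖h x‖ + ‖p x‖)) := by
      refine (neg_le_abs _).trans ((Complex.abs_re_le_norm _).trans ?_)
      refine (norm_inner_le_norm _ _).trans ?_
      gcongr
      refine (norm_add_le _ _).trans ?_
      rw [norm_smul, norm_mul, Complex.norm_I, one_mul, Complex.norm_intCast]
      have h1 := H.norm_apply_le (p.comp A) x
      have h2 := H.norm_apply_le (p.comp K) x
      have h3 : ‖p (K x)‖ ≤ |(n : ℝ)| * (‖p.comp K‖ * M * (‖h x‖ + ‖p x‖)) :=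
        h2.trans (le_mul_of_one_le_left (by positivity) hn1)
      have h4 := mul_le_mul_of_nonneg_left h1 hn0.le
      simp only [ContinuousLinearMap.comp_apply] at h4
      simp only [b]
      nlinarith
    have e3 := mul_le_mul_of_nonneg_left (H.p_B x) (sq_nonneg |(n : ℝ)|)
    have e4 : b * |(n : ℝ)| ≤ c / 2 * |(n : ℝ)| ^ 2 := by
      rw [div_le_iff₀ hc] at hn2
      nlinarith
    have e5 := mul_le_mul_of_nonneg_right e4 (sq_nonneg ‖p x‖)
    have e6 : b * (|(n : ℝ)| * (‖p x‖ * ‖h x‖))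
        ≤ (a + b + β + 1) * (|(n : ℝ)| * (‖p x‖ * ‖h x‖)) := by
      gcongr
      linarith
    rw [e1]
    nlinarith

/-! ### The exponential flow of the symbol -/

/-- The one-parameter group generated by a bounded operator. -/
def flow (G : X →L[ℂ] X) (t : ℝ) : X →L[ℂ] X := NormedSpace.exp (t • G)

theorem flow_zero (G : X →L[ℂ] X) : flow G 0 = ContinuousLinearMap.id ℂ X := by
  rw [flow, zero_smul, NormedSpace.exp_zero]
  rfl

variable [CompleteSpace X]

theorem flow_add (G : X →L[ℂ] X) (s t : ℝ) : flow G (s + t) = (flow G s).comp (flow G t) := by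
  let _ : NormedAlgebra ℚ (X →L[ℂ] X) := NormedAlgebra.restrictScalars ℚ ℝ _
  rw [flow, add_smul, NormedSpace.exp_add_of_commute
    (((Commute.refl G).smul_left s).smul_right t)]
  rfl

theorem hasDerivAt_flow (G : X →L[ℂ] X) (x : X) (t : ℝ) :
    HasDerivAt (fun s => flow G s x) (G (flow G t x)) t :=
  ((ContinuousLinearMap.apply ℂ X x).restrictScalars ℝ).hasFDerivAt.comp_hasDerivAt t
    (hasDerivAt_exp_smul_const' (𝕂 := ℝ) G t)

theorem flow_apply_comm (G : X →L[ℂ] X) (x : X) (t : ℝ) : flow G t (G x) = G (flow G t x) :=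
  (((ContinuousLinearMap.apply ℂ X x).restrictScalars ℝ).hasFDerivAt.comp_hasDerivAt t
    (hasDerivAt_exp_smul_const (𝕂 := ℝ) G t)).unique (hasDerivAt_flow G x t)

theorem continuous_flow (G : X →L[ℂ] X) (x : X) : Continuous fun t => flow G t x :=
  continuous_iff_continuousAt.2 fun t => (hasDerivAt_flow G x t).continuousAt

/-! ### Bounds on the flow, uniform in the frequency -/

theorem exists_norm_flow_le (G : X →L[ℂ] X) (T : ℝ) :
    ∃ C, 0 ≤ C ∧ ∀ t ∈ Set.Icc 0 T, ‖flow G t‖ ≤ C := by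
  have hc : Continuous fun t => ‖flow G t‖ :=
    continuous_norm.comp (continuous_iff_continuousAt.2 fun t =>
      (hasDerivAt_exp_smul_const (𝕂 := ℝ) G t).continuousAt)
  obtain ⟨C, hC⟩ := (isCompact_Icc (a := (0 : ℝ)) (b := T)).bddAbove_image hc.continuousOn
  exact ⟨max C 0, le_max_right _ _, fun t ht => (hC ⟨t, ht, rfl⟩).trans (le_max_left _ _)⟩

theorem IsAdapted.exists_flow_estimate (H : IsAdapted A B h p c β M) (K : X →L[ℂ] X) {k : ℕ}
    (hk : k = 1 ∨ k = 2 ∧ β = 0) (T : ℝ) :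
    ∃ C N : ℝ, 0 ≤ C ∧ 1 ≤ N ∧ ∀ n : ℤ, N ≤ |(n : ℝ)| → ∀ x, ∀ t ∈ Set.Icc 0 T,
      ‖h (flow (symbol A B K n) t x)‖ ≤ C * (‖h x‖ + ‖p x‖ / |(n : ℝ)| ^ k) ∧
      ‖p (flow (symbol A B K n) t x)‖ ≤ Real.exp (-(c / 2 * |(n : ℝ)| ^ 2) * t) * ‖p x‖
        + C * (‖h x‖ + ‖p x‖ / |(n : ℝ)| ^ k) / |(n : ℝ)| := by
  obtain ⟨C, N, hC, hN, hen⟩ := H.exists_energy_le K hk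
  obtain ⟨C', hC', hest⟩ := exists_transport_damping_estimate (E := E) (F := F) (T := T) hC
    (half_pos H.c_pos)
  refine ⟨C', N, hC', hN, fun n hn x t ht => ?_⟩
  have key := hest (r := |(n : ℝ)|) (k := k) (h := fun s => h (flow (symbol A B K n) s x))
    (p := fun s => p (flow (symbol A B K n) s x)) (hN.trans hn) (by omega)
    (fun s => (h.restrictScalars ℝ).hasFDerivAt.comp_hasDerivAt s (hasDerivAt_flow _ x s))
    (fun s => (p.restrictScalars ℝ).hasFDerivAt.comp_hasDerivAt s (hasDerivAt_flow _ x s))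
    (fun s => (hen n hn _).1) (fun s => (hen n hn _).2) t ht
  simpa only [flow_zero, ContinuousLinearMap.id_apply] using key

/-- The flows of the symbols are bounded on bounded time intervals, uniformly in the frequency. -/
theorem IsAdapted.exists_uniform_bound (H : IsAdapted A B h p c β M) (K : X →L[ℂ] X) (T : ℝ) :
    ∃ C : ℝ, 0 ≤ C ∧ ∀ n : ℤ, ∀ t ∈ Set.Icc 0 T, ‖flow (symbol A B K n) t‖ ≤ C := by
  obtain ⟨C, N, hC, hN, hest⟩ := H.exists_flow_estimate K (Or.inl rfl) T
  choose Q hQ0 hQ using fun n : ℤ => exists_norm_flow_le (symbol A B K n) T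
  have hM := H.M_nonneg
  -- The finitely many frequencies outside the energy estimate are bounded one by one, by
  -- compactness of the time interval.
  have hfin : {n : ℤ | |(n : ℝ)| < N}.Finite := by
    refine (Set.finite_Icc (-⌈N⌉) ⌈N⌉).subset fun n hn => ?_
    have hn' : |(n : ℝ)| < N := hn
    have h1 := abs_lt.1 hn'
    have h2 := Int.le_ceil N
    constructor
    · have : (-⌈N⌉ : ℝ) ≤ n := by linarith
      exact_mod_cast this
    · have : (n : ℝ) ≤ ⌈N⌉ := by linarith
      exact_mod_cast this
  have hS : 0 ≤ ∑ n ∈ hfin.toFinset, Q n := Finset.sum_nonneg fun n _ => hQ0 n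
  refine ⟨M * ((2 * C + 1) * (‖h‖ + ‖p‖)) + ∑ n ∈ hfin.toFinset, Q n, by positivity,
    fun n t ht => ?_⟩
  rcases lt_or_ge |(n : ℝ)| N with hn | hn
  · refine (hQ n t ht).trans ((Finset.single_le_sum (f := Q) (fun n _ => hQ0 n)
      (hfin.mem_toFinset.2 hn)).trans ?_)
    have : 0 ≤ M * ((2 * C + 1) * (‖h‖ + ‖p‖)) := by positivity
    linarith
  · refine ContinuousLinearMap.opNorm_le_bound _ (by positivity) fun x => ?_
    have hn1 : 1 ≤ |(n : ℝ)| := hN.trans hn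
    obtain ⟨h1, h2⟩ := hest n hn x t ht
    have h3 : ‖p x‖ / |(n : ℝ)| ^ 1 ≤ ‖p x‖ := div_le_self (norm_nonneg _) (by simpa using hn1)
    have h4 : C * (‖h x‖ + ‖p x‖ / |(n : ℝ)| ^ 1) ≤ C * (‖h x‖ + ‖p x‖) := by gcongr
    have h5 : C * (‖h x‖ + ‖p x‖ / |(n : ℝ)| ^ 1) / |(n : ℝ)|
        ≤ C * (‖h x‖ + ‖p x‖ / |(n : ℝ)| ^ 1) := div_le_self (by positivity) hn1
    have h6 : Real.exp (-(c / 2 * |(n : ℝ)| ^ 2) * t) * ‖p x‖ ≤ 1 * ‖p x‖ := by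
      gcongr
      rw [Real.exp_le_one_iff]
      have := mul_nonneg (by have := H.c_pos; positivity : 0 ≤ c / 2 * |(n : ℝ)| ^ 2) ht.1
      linarith
    have h7 : ‖h x‖ + ‖p x‖ ≤ (‖h‖ + ‖p‖) * ‖x‖ := by
      rw [add_mul]
      exact add_le_add (h.le_opNorm x) (p.le_opNorm x)
    calc ‖flow (symbol A B K n) t x‖
        ≤ M * (‖h (flow (symbol A B K n) t x)‖ + ‖p (flow (symbol A B K n) t x)‖) := H.norm_le _
      _ ≤ M * ((2 * C + 1) * (‖h x‖ + ‖p x‖)) := by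
          gcongr
          nlinarith [norm_nonneg (h x)]
      _ ≤ M * ((2 * C + 1) * ((‖h‖ + ‖p‖) * ‖x‖)) := by gcongr
      _ = M * ((2 * C + 1) * (‖h‖ + ‖p‖)) * ‖x‖ := by ring
      _ ≤ _ := by
          gcongr
          linarith

/-- At positive times, the flow gains `k` derivatives over the damped part of the data. -/
theorem IsAdapted.exists_smoothing_bound (H : IsAdapted A B h p c β M) (K : X →L[ℂ] X) {k : ℕ}
    (hk : k = 1 ∨ k = 2 ∧ β = 0) {t : ℝ} (ht : 0 < t) :
    ∃ C N : ℝ, ∀ n : ℤ, N ≤ |(n : ℝ)| → ∀ x,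
      |(n : ℝ)| ^ k * ‖flow (symbol A B K n) t x‖ ≤ C * (|(n : ℝ)| ^ k * ‖h x‖ + ‖p x‖) := by
  obtain ⟨C, N, hC, hN, hest⟩ := H.exists_flow_estimate K hk t
  have hM := H.M_nonneg
  have hc := H.c_pos
  refine ⟨M * (2 * C + 2 / (c * t)), N, fun n hn x => ?_⟩
  set r := |(n : ℝ)|
  have hr1 : 1 ≤ r := hN.trans hn
  have hr0 : 0 < r := by linarith
  obtain ⟨h1, h2⟩ := hest n hn x t (Set.right_mem_Icc.2 ht.le)
  have h3 : r ^ k * (C * (‖h x‖ + ‖p x‖ / r ^ k)) = C * (r ^ k * ‖h x‖ + ‖p x‖) := by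
    field_simp
  have h4 : C * (‖h x‖ + ‖p x‖ / r ^ k) / r ≤ C * (‖h x‖ + ‖p x‖ / r ^ k) :=
    div_le_self (by positivity) hr1
  -- Positivity of the time is essential here: `s ≤ exp s` at `s = c / 2 * r ^ 2 * t` bounds `r ^ 2
  -- * exp (-s)`, and `k ≤ 2`.
  have h5 : r ^ k * Real.exp (-(c / 2 * r ^ 2) * t) ≤ 2 / (c * t) := by
    have hk2 : r ^ k ≤ r ^ 2 := pow_le_pow_right₀ hr1 (by omega)
    have h6 : c / 2 * r ^ 2 * t ≤ Real.exp (c / 2 * r ^ 2 * t) := by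
      linarith [Real.add_one_le_exp (c / 2 * r ^ 2 * t)]
    have h7 : Real.exp (c / 2 * r ^ 2 * t) * Real.exp (-(c / 2 * r ^ 2) * t) = 1 := by
      rw [← Real.exp_add]
      simp
    have h8 := mul_le_mul_of_nonneg_right h6 (Real.exp_pos (-(c / 2 * r ^ 2) * t)).le
    rw [h7] at h8
    rw [le_div_iff₀ (by positivity)]
    have h9 := mul_le_mul_of_nonneg_right hk2 (Real.exp_pos (-(c / 2 * r ^ 2) * t)).le
    nlinarith [mul_le_mul_of_nonneg_right h9 (by positivity : 0 ≤ c * t)]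
  have h6 := mul_le_mul_of_nonneg_left h1 (by positivity : 0 ≤ r ^ k)
  have h7 := mul_le_mul_of_nonneg_left (h2.trans (add_le_add_right h4 _))
    (by positivity : 0 ≤ r ^ k)
  have h8 := mul_le_mul_of_nonneg_right h5 (norm_nonneg (p x))
  have h9 := mul_le_mul_of_nonneg_left (H.norm_le (flow (symbol A B K n) t x))
    (by positivity : 0 ≤ r ^ k)
  rw [mul_add, h3] at h7
  rw [h3] at h6
  have h10 : r ^ k * ‖h (flow (symbol A B K n) t x)‖ + r ^ k * ‖p (flow (symbol A B K n) t x)‖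
      ≤ (2 * C + 2 / (c * t)) * (r ^ k * ‖h x‖ + ‖p x‖) := by
    have : 0 ≤ 2 / (c * t) * (r ^ k * ‖h x‖) := by positivity
    nlinarith
  have h11 := mul_le_mul_of_nonneg_left h10 hM
  nlinarith

end Flow

open scoped Matrix

/-! ### The adapted inner products for a parabolic-transport system -/

/-- The action of a real matrix on complex vectors. -/
def complexAction {ι : Type*} [Fintype ι] [DecidableEq ι] (M : Matrix ι ι ℝ) :
    (ι → ℂ) →L[ℂ] (ι → ℂ) :=
  LinearMap.toContinuousLinearMap (Matrix.toLin' (M.map (algebraMap ℝ ℂ)))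

theorem complexAction_apply {ι : Type*} [Fintype ι] [DecidableEq ι] (M : Matrix ι ι ℝ)
    (x : ι → ℂ) : complexAction M x = M.map (algebraMap ℝ ℂ) *ᵥ x := rfl

theorem im_eq_zero_of_isDiagonalizable {m : ℕ} {M P : Matrix (Fin m) (Fin m) ℂ} (hP : IsUnit P.det)
    {v : Fin m → ℂ} (hM : M = P * Matrix.diagonal v * P⁻¹) (h : ∀ μ ∈ spectrum ℂ M, μ.im = 0)
    (i : Fin m) : (v i).im = 0 := by
  apply h
  have e : M = (Matrix.nonsingInvUnit P hP : Matrix (Fin m) (Fin m) ℂ) * Matrix.diagonal v *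
      ((Matrix.nonsingInvUnit P hP)⁻¹ : (Matrix (Fin m) (Fin m) ℂ)ˣ) := by
    rw [hM, Matrix.coe_units_inv]
    rfl
  rw [e, spectrum.units_conjugate, _root_.spectrum_diagonal]
  exact ⟨i, rfl⟩

theorem im_inner_diagonal_eq_zero {m : ℕ} {v : Fin m → ℂ} (hv : ∀ i, (v i).im = 0)
    (y : Fin m → ℂ) :
    (inner ℂ (WithLp.toLp 2 y : EuclideanSpace ℂ (Fin m))
      (WithLp.toLp 2 (Matrix.diagonal v *ᵥ y))).im = 0 := by
  rw [PiLp.inner_apply, Complex.im_sum]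
  refine Finset.sum_eq_zero fun i _ => ?_
  change (inner ℂ (y i) ((Matrix.diagonal v *ᵥ y) i)).im = 0
  rw [Matrix.mulVec_diagonal, RCLike.inner_apply, mul_assoc]
  have h2 : y i * (starRingEnd ℂ) (y i) = ((‖y i‖ ^ 2 : ℝ) : ℂ) := by
    rw [Complex.mul_conj']
    push_cast
    rfl
  rw [h2, Complex.im_mul_ofReal, hv i, zero_mul]

variable {dh dp : ℕ}

theorem complexAction_comp_inl (A : Matrix (Fin dh ⊕ Fin dp) (Fin dh ⊕ Fin dp) ℝ)
    (x : Fin dh ⊕ Fin dp → ℂ) : complexAction A x ∘ Sum.inl =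
      toComplex A.toBlocks₁₁ *ᵥ (x ∘ Sum.inl)
        + A.toBlocks₁₂.map (algebraMap ℝ ℂ) *ᵥ (x ∘ Sum.inr) := by
  rw [complexAction_apply]
  conv_lhs => rw [← Matrix.fromBlocks_toBlocks A, Matrix.fromBlocks_map, Matrix.fromBlocks_mulVec]
  rfl

theorem complexAction_comp_inr (A : Matrix (Fin dh ⊕ Fin dp) (Fin dh ⊕ Fin dp) ℝ)
    (x : Fin dh ⊕ Fin dp → ℂ) : complexAction A x ∘ Sum.inr =
      A.toBlocks₂₁.map (algebraMap ℝ ℂ) *ᵥ (x ∘ Sum.inl)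
        + toComplex A.toBlocks₂₂ *ᵥ (x ∘ Sum.inr) := by
  rw [complexAction_apply]
  conv_lhs => rw [← Matrix.fromBlocks_toBlocks A, Matrix.fromBlocks_map, Matrix.fromBlocks_mulVec]
  rfl

/-- A linear map on complex vectors, precomposed with a restriction of the index set. -/
def restrictCLM {ι κ : Type*} [Fintype κ] {F : Type*} [NormedAddCommGroup F]
    [NormedSpace ℂ F] (e : (κ → ℂ) →ₗ[ℂ] F) (s : κ → ι) : (ι → ℂ) →L[ℂ] F :=
  (LinearMap.toContinuousLinearMap e).comp
    (ContinuousLinearMap.pi fun i => ContinuousLinearMap.proj (s i))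

theorem restrictCLM_apply {ι κ : Type*} [Fintype κ] {F : Type*}
    [NormedAddCommGroup F] [NormedSpace ℂ F] (e : (κ → ℂ) →ₗ[ℂ] F) (s : κ → ι) (x : ι → ℂ) :
    restrictCLM e s x = e (x ∘ s) := rfl

theorem exists_norm_le_mul_norm_apply {κ : Type*} [Fintype κ] {F : Type*} [NormedAddCommGroup F]
    [NormedSpace ℂ F] (e : (κ → ℂ) →ₗ[ℂ] F) (he : Function.Injective e) :
    ∃ C : ℝ, 0 ≤ C ∧ ∀ x, ‖x‖ ≤ C * ‖e x‖ := by
  obtain ⟨C, -, hC⟩ := e.exists_antilipschitzWith (LinearMap.ker_eq_bot.2 he)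
  exact ⟨C, C.2, fun x => hC.le_mul_norm (map_zero e) x⟩

theorem exists_norm_apply_le {κ : Type*} [Fintype κ] {F : Type*} [NormedAddCommGroup F]
    [NormedSpace ℂ F] (e : (κ → ℂ) →ₗ[ℂ] F) : ∃ C : ℝ, 0 ≤ C ∧ ∀ x, ‖e x‖ ≤ C * ‖x‖ :=
  ⟨‖LinearMap.toContinuousLinearMap e‖, norm_nonneg _,
    fun x => (LinearMap.toContinuousLinearMap e).le_opNorm x⟩

/-- The transported part is read in eigenvector coordinates, where the block `A'` is a real diagonal
matrix and hence Hermitian; the damped part uses the inner product that makes `D` accretive. The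
constant `β` is proportional to the norm of the block `A₁₂` in these coordinates. -/
theorem exists_isAdapted (A B : Matrix (Fin dh ⊕ Fin dp) (Fin dh ⊕ Fin dp) ℝ)
    (D : Matrix (Fin dp) (Fin dp) ℝ) (hB : B = Matrix.fromBlocks 0 0 0 D)
    (hD : ∀ μ ∈ spectrum ℂ (toComplex D), 0 < μ.re)
    (hA : IsDiagonalizable (toComplex A.toBlocks₁₁))
    (hA_real : ∀ μ ∈ spectrum ℂ (toComplex A.toBlocks₁₁), μ.im = 0) :
    ∃ (F : Type) (_ : NormedAddCommGroup F) (_ : InnerProductSpace ℂ F)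
      (eh : (Fin dh → ℂ) →ₗ[ℂ] EuclideanSpace ℂ (Fin dh)) (ep : (Fin dp → ℂ) →ₗ[ℂ] F)
      (c β M : ℝ), IsAdapted (complexAction A) (complexAction B) (restrictCLM eh Sum.inl)
        (restrictCLM ep Sum.inr) c β M ∧ (A.toBlocks₁₂ = 0 → β = 0) := by
  obtain ⟨F, iF, iF', ep, c, hep, hc, hacc⟩ := exists_accretive_embedding dp (Fin dp → ℂ)
    (by simp) (Matrix.toLin' (toComplex D)) fun μ hμ => hD μ <| by
      rwa [Module.End.hasEigenvalue_iff_mem_spectrum, Matrix.spectrum_toLin'] at hμ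
  obtain ⟨P, hP, v, hPv⟩ := hA
  let eh : (Fin dh → ℂ) →ₗ[ℂ] EuclideanSpace ℂ (Fin dh) :=
    (WithLp.linearEquiv 2 ℂ (Fin dh → ℂ)).symm.toLinearMap ∘ₗ Matrix.toLin' P⁻¹
  have heh : ∀ y, eh y = WithLp.toLp 2 (P⁻¹ *ᵥ y) := fun y => rfl
  have hehi : Function.Injective eh := by
    rw [injective_iff_map_eq_zero]
    intro y hy
    have h1 : P⁻¹ *ᵥ y = 0 := by
      have := congr_arg WithLp.ofLp hy
      simpa [heh] using this
    have h2 := congr_arg (P *ᵥ ·) h1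
    simpa [Matrix.mulVec_mulVec, Matrix.mul_nonsing_inv _ hP] using h2
  obtain ⟨Ch, hCh0, hCh⟩ := exists_norm_le_mul_norm_apply eh hehi
  obtain ⟨Cp, hCp0, hCp⟩ := exists_norm_le_mul_norm_apply ep hep
  let W : (Fin dp → ℂ) →L[ℂ] EuclideanSpace ℂ (Fin dh) := LinearMap.toContinuousLinearMap
    (eh ∘ₗ Matrix.toLin' (A.toBlocks₁₂.map (algebraMap ℝ ℂ)))
  have hW : ∀ y, W y = eh (A.toBlocks₁₂.map (algebraMap ℝ ℂ) *ᵥ y) := fun y => rfl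
  refine ⟨F, iF, iF', eh, ep, c, ‖W‖ * Cp, Ch + Cp, ⟨hc, by positivity, by positivity,
    fun x => ?_, fun x => ?_, fun x => ?_, fun x => ?_⟩, fun h0 => ?_⟩
  · rw [restrictCLM_apply, complexAction_comp_inl, hB]
    simp [toComplex]
  · rw [restrictCLM_apply, restrictCLM_apply, complexAction_comp_inr, hB]
    simpa [Matrix.map_zero] using hacc (x ∘ Sum.inr)
  · rw [restrictCLM_apply, restrictCLM_apply, restrictCLM_apply, complexAction_comp_inl, map_add,
      inner_add_right, Complex.add_im]
    have h1 : (inner ℂ (eh (x ∘ Sum.inl))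
        (eh (toComplex A.toBlocks₁₁ *ᵥ (x ∘ Sum.inl)))).im = 0 := by
      have e : P⁻¹ *ᵥ (toComplex A.toBlocks₁₁ *ᵥ (x ∘ Sum.inl))
          = Matrix.diagonal v *ᵥ (P⁻¹ *ᵥ (x ∘ Sum.inl)) := by
        rw [hPv, Matrix.mulVec_mulVec, Matrix.mulVec_mulVec, Matrix.mul_assoc P,
          ← Matrix.mul_assoc P⁻¹, Matrix.nonsing_inv_mul _ hP, Matrix.one_mul]
      rw [heh, heh, e]
      exact im_inner_diagonal_eq_zero (im_eq_zero_of_isDiagonalizable hP hPv hA_real) _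
    rw [h1, zero_add, ← hW]
    refine (Complex.abs_im_le_norm _).trans ((norm_inner_le_norm _ _).trans ?_)
    calc ‖eh (x ∘ Sum.inl)‖ * ‖W (x ∘ Sum.inr)‖
        ≤ ‖eh (x ∘ Sum.inl)‖ * (‖W‖ * (Cp * ‖ep (x ∘ Sum.inr)‖)) := by
          gcongr
          exact W.le_opNorm_of_le (hCp _)
      _ = _ := by ring
  · rw [restrictCLM_apply, restrictCLM_apply]
    have hx1 := hCh (x ∘ Sum.inl)
    have hx2 := hCp (x ∘ Sum.inr)
    have h3 : 0 ≤ Ch * ‖eh (x ∘ Sum.inl)‖ := by positivity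
    have h4 : 0 ≤ Cp * ‖ep (x ∘ Sum.inr)‖ := by positivity
    have h5 : 0 ≤ Ch * ‖ep (x ∘ Sum.inr)‖ := by positivity
    have h6 : 0 ≤ Cp * ‖eh (x ∘ Sum.inl)‖ := by positivity
    refine (pi_norm_le_iff_of_nonneg (by positivity)).2 ?_
    rintro (i | j)
    · have := norm_le_pi_norm (x ∘ Sum.inl) i
      simp only [Function.comp_apply] at this
      nlinarith
    · have := norm_le_pi_norm (x ∘ Sum.inr) j
      simp only [Function.comp_apply] at this
      nlinarith
  · have : W = 0 := by
      ext1 y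
      rw [hW, h0]
      simp
    rw [this, norm_zero, zero_mul]

/-! ### Semigroups of Fourier multipliers -/

section Slope

variable {X : Type*} [NormedAddCommGroup X] [NormedSpace ℂ X]

theorem tendsto_toNNReal_sub_nhdsGT (t : ℝ) :
    Tendsto (fun s : ℝ => (s - t).toNNReal) (𝓝[>] t) (𝓝[>] 0) := by
  refine tendsto_nhdsWithin_iff.2 ⟨?_, ?_⟩
  · apply tendsto_nhdsWithin_of_tendsto_nhds
    have h : Continuous fun s : ℝ => (s - t).toNNReal := by fun_prop
    simpa using h.tendsto t
  · filter_upwards [self_mem_nhdsWithin] with s hs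
    exact Real.toNNReal_pos.2 (sub_pos.2 hs)

theorem tendsto_coe_nhdsGT_zero : Tendsto (fun s : ℝ≥0 => (s : ℝ)) (𝓝[>] 0) (𝓝[>] 0) := by
  refine tendsto_nhdsWithin_iff.2 ⟨?_, ?_⟩
  · apply tendsto_nhdsWithin_of_tendsto_nhds
    simpa using NNReal.continuous_coe.tendsto 0
  · filter_upwards [self_mem_nhdsWithin] with s hs
    exact NNReal.coe_pos.2 hs

theorem tendsto_slope_flow [CompleteSpace X] (G : X →L[ℂ] X) (x : X) :
    Tendsto (fun t : ℝ≥0 => (((t : ℝ) : ℂ)⁻¹) • (flow G t x - x)) (𝓝[>] 0) (𝓝 (G x)) := by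
  have h := (hasDerivAt_flow G x 0).hasDerivWithinAt (s := Set.Ioi 0)
  rw [hasDerivWithinAt_iff_tendsto_slope' (by simp), flow_zero] at h
  refine (h.comp tendsto_coe_nhdsGT_zero).congr fun t => ?_
  rw [Function.comp_apply, slope_def_module, flow_zero, sub_zero, ← Complex.ofReal_inv,
    Complex.coe_smul]
  rfl

/-- The derivative of the orbit is the flow applied to `G x`. The bound thus involves `‖G x‖` but
not `‖G‖`, which is unbounded over the frequencies. -/
theorem norm_flow_sub_le [CompleteSpace X] (G : X →L[ℂ] X) (x : X) {C T : ℝ}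
    (hC : ∀ t ∈ Set.Icc 0 T, ‖flow G t‖ ≤ C) {t : ℝ} (ht : t ∈ Set.Icc 0 T) :
    ‖flow G t x - x‖ ≤ C * ‖G x‖ * t := by
  have h := norm_image_sub_le_of_norm_deriv_le_segment' (f := fun s => flow G s x)
    (f' := fun s => G (flow G s x)) (a := 0) (b := T) (C := C * ‖G x‖)
    (fun s _ => (hasDerivAt_flow G x s).hasDerivWithinAt) (fun s hs => by
      rw [← flow_apply_comm]
      exact (flow G s).le_of_opNorm_le (hC s (Set.Ico_subset_Icc_self hs)) _) t ht
  simpa [flow_zero] using h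

end Slope

variable {ι : Type*} [Fintype ι]

/-- The graph of the unbounded Fourier multiplier with symbol `G`, on its maximal domain. -/
def symbolGraph (G : ℤ → (ι → ℂ) →L[ℂ] (ι → ℂ)) : Set ((ι → L2T) × (ι → L2T)) :=
  {p | ∀ n, coeff n p.2 = G n (coeff n p.1)}

theorem isClosed_symbolGraph (G : ℤ → (ι → ℂ) →L[ℂ] (ι → ℂ)) : IsClosed (symbolGraph G) := by
  have e : symbolGraph G = ⋂ n, {p | coeff n p.2 = G n (coeff n p.1)} := by
    ext p
    simp [symbolGraph]
  rw [e]
  exact isClosed_iInter fun n => isClosed_eq (by fun_prop) (by fun_prop)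

open Classical in
theorem exists_truncation (s : Finset ℤ) : ∃ P : (ι → L2T) →L[ℂ] (ι → L2T),
    ∀ n f, coeff n (P f) = if n ∈ s then coeff n f else 0 := by
  obtain ⟨P, hP⟩ := exists_multiplier (ι := ι) (C := 1)
    (fun n => if n ∈ s then ContinuousLinearMap.id ℂ _ else 0) fun n => by
      split_ifs
      · exact ContinuousLinearMap.norm_id_le
      · simp
  refine ⟨P, fun n f => ?_⟩
  rw [hP]
  split_ifs <;> rfl

/-- The truncation of Fourier series to a finite set of frequencies. -/
def truncation (s : Finset ℤ) : (ι → L2T) →L[ℂ] (ι → L2T) := (exists_truncation s).choose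

theorem coeff_truncation_of_mem {s : Finset ℤ} {n : ℤ} (h : n ∈ s) (f : ι → L2T) :
    coeff n (truncation s f) = coeff n f := by
  rw [truncation, (exists_truncation s).choose_spec, if_pos h]

theorem coeff_truncation_of_notMem {s : Finset ℤ} {n : ℤ} (h : n ∉ s) (f : ι → L2T) :
    coeff n (truncation s f) = 0 := by
  rw [truncation, (exists_truncation s).choose_spec, if_neg h]

theorem tendsto_truncation (f : ι → L2T) :
    Tendsto (fun s : Finset ℤ => truncation s f) atTop (𝓝 f) := by
  refine tendsto_of_coeff (summable_sq_coeff f) (fun n => ?_) (Eventually.of_forall fun s n => ?_)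
  · refine tendsto_const_nhds.congr' ?_
    filter_upwards [eventually_ge_atTop {n}] with s hs
    rw [coeff_truncation_of_mem (hs (Finset.mem_singleton_self n))]
  · by_cases h : n ∈ s
    · rw [coeff_truncation_of_mem h, sub_self, norm_zero]
      exact sq_nonneg _ |>.trans' (by simp)
    · rw [coeff_truncation_of_notMem h, zero_sub, norm_neg]

theorem memH_truncation (s : Finset ℤ) (f : ι → L2T) (i : ι) (k : ℕ) :
    MemH k (truncation s f i) := by
  rw [memH_iff]
  refine summable_of_ne_finset_zero (s := s) fun n hn => ?_
  rw [← coeff_apply, coeff_truncation_of_notMem hn]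
  simp

theorem exists_truncation_mem_symbolGraph (G : ℤ → (ι → ℂ) →L[ℂ] (ι → ℂ)) (s : Finset ℤ)
    (f : ι → L2T) : ∃ g, (truncation s f, g) ∈ symbolGraph G :=
  exists_coeff_eq (x := fun n => G n (coeff n (truncation s f))) <| summable_of_ne_finset_zero (s := s) fun n hn => by
    simp [coeff_truncation_of_notMem hn]

variable {G : ℤ → (ι → ℂ) →L[ℂ] (ι → ℂ)} {S : ℝ≥0 → (ι → L2T) →L[ℂ] (ι → L2T)}

theorem exists_multiplier_semigroup
    (hG : ∀ T : ℝ, ∃ C : ℝ, 0 ≤ C ∧ ∀ n : ℤ, ∀ t ∈ Set.Icc 0 T, ‖flow (G n) t‖ ≤ C) :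
    ∃ S : ℝ≥0 → (ι → L2T) →L[ℂ] (ι → L2T),
      ∀ t n f, coeff n (S t f) = flow (G n) t (coeff n f) := by
  have h : ∀ t : ℝ≥0, ∃ S : (ι → L2T) →L[ℂ] (ι → L2T),
      ∀ n f, coeff n (S f) = flow (G n) t (coeff n f) := fun t => by
    obtain ⟨C, -, hC⟩ := hG t
    exact exists_multiplier _ fun n => hC n t ⟨t.2, le_rfl⟩
  choose S hS using h
  exact ⟨S, hS⟩

theorem isC0Semigroup_of_coeff
    (hG : ∀ T : ℝ, ∃ C : ℝ, 0 ≤ C ∧ ∀ n : ℤ, ∀ t ∈ Set.Icc 0 T, ‖flow (G n) t‖ ≤ C)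
    (hS : ∀ t n f, coeff n (S t f) = flow (G n) t (coeff n f)) : IsC0Semigroup S where
  map_zero := by
    ext1 f
    exact ext_coeff fun n => by
      rw [hS, NNReal.coe_zero, flow_zero]
      rfl
  map_add s t := by
    ext1 f
    exact ext_coeff fun n => by
      rw [ContinuousLinearMap.comp_apply, hS, hS, hS, NNReal.coe_add, flow_add]
      rfl
  continuous_orbit f := by
    refine continuous_iff_continuousAt.2 fun t₀ => ?_
    obtain ⟨C, hC0, hC⟩ := hG (t₀ + 1)
    refine tendsto_of_coeff (b := fun n => (2 * C) ^ 2 * ‖coeff n f‖ ^ 2)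
      ((summable_sq_coeff f).mul_left _) (fun n => ?_) ?_
    · simp only [hS]
      exact ((continuous_flow (G n) (coeff n f)).comp NNReal.continuous_coe).tendsto t₀
    · filter_upwards [eventually_le_nhds (lt_add_one t₀)] with t ht n
      rw [hS, hS, ← mul_pow]
      gcongr
      have h1 : ‖flow (G n) t (coeff n f)‖ ≤ C * ‖coeff n f‖ :=
        ContinuousLinearMap.le_of_opNorm_le _ (hC n t ⟨t.2, by exact_mod_cast ht⟩) _
      have h2 : ‖flow (G n) t₀ (coeff n f)‖ ≤ C * ‖coeff n f‖ :=
        ContinuousLinearMap.le_of_opNorm_le _ (hC n t₀ ⟨t₀.2, by linarith⟩) _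
      linarith [norm_sub_le (flow (G n) t (coeff n f)) (flow (G n) t₀ (coeff n f))]

/-- Taking coefficients gives one inclusion. Conversely, for a pair in the symbol graph the
difference quotient at frequency `n` is at most `C * ‖coeff n g‖`, uniformly in small times, so
dominated convergence applies. -/
theorem generatorGraph_eq_symbolGraph
    (hG : ∀ T : ℝ, ∃ C : ℝ, 0 ≤ C ∧ ∀ n : ℤ, ∀ t ∈ Set.Icc 0 T, ‖flow (G n) t‖ ≤ C)
    (hS : ∀ t n f, coeff n (S t f) = flow (G n) t (coeff n f)) :
    generatorGraph S = symbolGraph G := by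
  have hc : ∀ (n : ℤ) (f : ι → L2T) (t : ℝ≥0),
      coeff n ((((t : ℝ) : ℂ)⁻¹) • (S t f - f))
        = (((t : ℝ) : ℂ)⁻¹) • (flow (G n) t (coeff n f) - coeff n f) := fun n f t => by
    rw [map_smul, map_sub, hS]
  ext ⟨f, g⟩
  constructor
  · intro h n
    have h1 := ((coeff n).continuous.tendsto g).comp (show Tendsto _ _ _ from h)
    refine tendsto_nhds_unique (h1.congr fun t => ?_) (tendsto_slope_flow (G n) (coeff n f))
    exact hc n f t
  · intro h
    obtain ⟨C, hC0, hC⟩ := hG 1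
    refine tendsto_of_coeff (b := fun n => (C + 1) ^ 2 * ‖coeff n g‖ ^ 2)
      ((summable_sq_coeff g).mul_left _) (fun n => ?_) ?_
    · simp only [hc]
      rw [h n]
      exact tendsto_slope_flow (G n) (coeff n f)
    · filter_upwards [self_mem_nhdsWithin,
        mem_nhdsWithin_of_mem_nhds (eventually_le_nhds (zero_lt_one (α := ℝ≥0)))] with t ht0 ht n
      have ht0' : 0 < (t : ℝ) := ht0
      rw [hc, ← mul_pow]
      gcongr
      have h1 : ‖flow (G n) t (coeff n f) - coeff n f‖ ≤ C * ‖G n (coeff n f)‖ * t :=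
        norm_flow_sub_le (G n) (coeff n f) (hC n) ⟨t.2, by exact_mod_cast ht⟩
      rw [← h n] at h1
      have h2 : ‖(((t : ℝ) : ℂ)⁻¹) • (flow (G n) t (coeff n f) - coeff n f)‖
          ≤ C * ‖coeff n g‖ := by
        rw [norm_smul, norm_inv, Complex.norm_real, Real.norm_of_nonneg ht0'.le,
          inv_mul_le_iff₀ ht0', mul_comm (t : ℝ)]
        exact h1
      linarith [norm_sub_le ((((t : ℝ) : ℂ)⁻¹) • (flow (G n) t (coeff n f) - coeff n f))
        (coeff n g)]

theorem IsC0Semigroup.mem_generatorGraph_apply {X : Type*} [NormedAddCommGroup X] [NormedSpace ℂ X]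
    {S : ℝ≥0 → X →L[ℂ] X} (hS : IsC0Semigroup S) {x y : X} (h : (x, y) ∈ generatorGraph S)
    (t : ℝ≥0) : (S t x, S t y) ∈ generatorGraph S := by
  have h1 := ((S t).continuous.tendsto y).comp (show Tendsto _ _ _ from h)
  refine h1.congr fun s => ?_
  have e : S s (S t x) = S t (S s x) := by
    rw [← ContinuousLinearMap.comp_apply, ← hS.map_add, add_comm, hS.map_add,
      ContinuousLinearMap.comp_apply]
  simp only [Function.comp_apply, map_smul, map_sub, e]

/-- Both sides solve the linear ODE with matrix `G n` and the same initial value. The generator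
supplies only right derivatives, which suffice for Grönwall. -/
theorem IsC0Semigroup.coeff_apply_of_mem (hS : IsC0Semigroup S)
    (hgen : generatorGraph S = symbolGraph G) {f g : ι → L2T} (h : (f, g) ∈ generatorGraph S)
    (t : ℝ≥0) (n : ℤ) : coeff n (S t f) = flow (G n) t (coeff n f) := by
  let d : ℝ → ι → ℂ := fun s => coeff n (S s.toNNReal f) - flow (G n) s (coeff n f)
  have hcont : Continuous d := by
    have h1 := hS.continuous_orbit f
    have h2 := continuous_flow (G n) (coeff n f)
    exact ((coeff n).continuous.comp (h1.comp continuous_real_toNNReal)).sub h2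
  have hder : ∀ s ∈ Set.Ico 0 (t : ℝ), HasDerivWithinAt d (G n (d s)) (Set.Ici s) s := by
    intro s hs
    have hg := hS.mem_generatorGraph_apply h s.toNNReal
    have hsym : coeff n (S s.toNNReal g) = G n (coeff n (S s.toNNReal f)) := by
      have h3 := hg
      rw [hgen] at h3
      exact h3 n
    have h1 : HasDerivWithinAt (fun r : ℝ => coeff n (S r.toNNReal f))
        (G n (coeff n (S s.toNNReal f))) (Set.Ici s) s := by
      rw [← hasDerivWithinAt_Ioi_iff_Ici, hasDerivWithinAt_iff_tendsto_slope' (by simp), ← hsym]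
      refine Tendsto.congr' ?_ (((coeff n).continuous.tendsto _).comp
        ((show Tendsto _ _ _ from hg).comp (tendsto_toNNReal_sub_nhdsGT s)))
      filter_upwards [self_mem_nhdsWithin] with r hr
      have hsr : s < r := hr
      have e : S (r - s).toNNReal (S s.toNNReal f) = S r.toNNReal f := by
        rw [← ContinuousLinearMap.comp_apply, ← hS.map_add,
          ← Real.toNNReal_add (by linarith) hs.1, sub_add_cancel]
      simp only [Function.comp_apply]
      rw [slope_def_module, e, map_smul, map_sub, Real.coe_toNNReal _ (by linarith),
        ← Complex.ofReal_inv, Complex.coe_smul]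
    have h2 := h1.sub (hasDerivAt_flow (G n) (coeff n f) s).hasDerivWithinAt
    rw [← map_sub] at h2
    exact h2
  have h0 : d 0 = 0 := by
    simp [d, hS.map_zero, flow_zero]
  have := eq_zero_of_abs_deriv_le_mul_abs_self_of_eq_zero_right hcont.continuousOn hder h0
    (K := ‖G n‖) (fun s _ => (G n).le_opNorm _) t ⟨t.2, le_rfl⟩
  simpa [d, sub_eq_zero] using this

/-- A strongly continuous semigroup whose generator is a Fourier multiplier is given by the
exponentials of the symbol. -/
theorem IsC0Semigroup.coeff_apply (hS : IsC0Semigroup S)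
    (hgen : generatorGraph S = symbolGraph G) (t : ℝ≥0) (n : ℤ) (f : ι → L2T) :
    coeff n (S t f) = flow (G n) t (coeff n f) := by
  -- Both sides are continuous in `f`, and truncations lie in the domain of the generator, so
  -- density reduces the claim to them.
  have h1 := ((coeff n).comp (S t)).continuous.continuousAt.tendsto.comp (tendsto_truncation f)
  have h2 := ((flow (G n) t).comp (coeff n)).continuous.continuousAt.tendsto.comp
    (tendsto_truncation f)
  refine tendsto_nhds_unique h1 (h2.congr fun s => ?_)
  obtain ⟨g, hg⟩ := exists_truncation_mem_symbolGraph G s f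
  exact (hS.coeff_apply_of_mem hgen (hgen ▸ hg) t n).symm

/-! ### The operator of the parabolic-transport system -/

variable {dh dp : ℕ} {A B K : Matrix (Fin dh ⊕ Fin dp) (Fin dh ⊕ Fin dp) ℝ}
  {D : Matrix (Fin dp) (Fin dp) ℝ}

/-- The symbol of `-ℒ` at frequency `n`. -/
def matrixSymbol (A B K : Matrix (Fin dh ⊕ Fin dp) (Fin dh ⊕ Fin dp) ℝ) (n : ℤ) :
    (Fin dh ⊕ Fin dp → ℂ) →L[ℂ] (Fin dh ⊕ Fin dp → ℂ) :=
  symbol (complexAction A) (complexAction B) (complexAction K) n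

theorem coeff_neg_opL (hB : B = Matrix.fromBlocks 0 0 0 D) {f : State dh dp}
    (hf : f ∈ sobolev dh dp 1 2) (n : ℤ) :
    coeff n (-opL A B K f) = matrixSymbol A B K n (coeff n f) := by
  have h1 : ∀ j, fourierCoeff (weakDeriv (f j)) n = Complex.I * n * fourierCoeff (f j) n := by
    rintro (j | j)
    · exact (hf.1 j).fourierCoeff_weakDeriv n
    · exact (hf.2 j).fourierCoeff_weakDeriv n
  have h2 : ∀ i j, (B i j : ℂ) * fourierCoeff (weakDeriv (weakDeriv (f j))) n
      = (B i j : ℂ) * (-(n : ℂ) ^ 2 * fourierCoeff (f j) n) := by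
    rintro i (j | j)
    -- A hyperbolic component is only in `H¹`, so its second `weakDeriv` may be the default value
    -- `0`; the vanishing columns of `B` make this irrelevant.
    · have : B i (Sum.inl j) = 0 := by rw [hB]; rcases i with i | i <;> rfl
      simp [this]
    · rw [(hf.2 j).weakDeriv.fourierCoeff_weakDeriv n, h1]
      linear_combination (B i (Sum.inr j) : ℂ) * (n : ℂ) ^ 2 * fourierCoeff (f (Sum.inr j)) n
        * Complex.I_sq
  have hsm : ∀ (r : ℝ) (g : L2T), fourierCoeffCLM n (r • g) = (r : ℂ) * fourierCoeff g n :=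
    fun r g => by
      rw [map_real_smul _ (fourierCoeffCLM n).continuous, fourierCoeffCLM_apply, Complex.real_smul]
  funext i
  rw [coeff_apply, ← fourierCoeffCLM_apply, matrixSymbol, symbol_apply]
  simp only [opL, Pi.neg_apply, Pi.add_apply, Pi.smul_apply, map_neg, map_add, map_sum, hsm, h1, h2,
    complexAction_apply, Matrix.mulVec, dotProduct, Matrix.map_apply, coeff_apply,
    Complex.coe_algebraMap, smul_eq_mul]
  congr 2
  congr 1
  · rw [Finset.mul_sum, ← Finset.sum_neg_distrib]
    exact Finset.sum_congr rfl fun j _ => by ring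
  · rw [Finset.mul_sum]
    exact Finset.sum_congr rfl fun j _ => by ring

/-- The symbol graph is closed and contains the graph of `-ℒ`. Conversely, truncation commutes with
the multiplier and yields trigonometric polynomials, which belong to the domain of `ℒ`. -/
theorem closure_negLGraph (hB : B = Matrix.fromBlocks 0 0 0 D) :
    closure (negLGraph A B K) = symbolGraph (matrixSymbol A B K) := by
  apply Set.Subset.antisymm
  · refine closure_minimal ?_ (isClosed_symbolGraph _)
    rintro ⟨f, g⟩ ⟨hf, hg⟩ n
    change coeff n g = _
    rw [show g = -opL A B K f from hg]
    exact coeff_neg_opL hB hf n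
  · rintro ⟨f, g⟩ h
    refine mem_closure_of_tendsto ((tendsto_truncation f).prodMk_nhds (tendsto_truncation g))
      (Eventually.of_forall fun s => ?_)
    have hs : truncation s f ∈ sobolev dh dp 1 2 :=
      ⟨fun i => memH_truncation s f _ 1, fun j => memH_truncation s f _ 2⟩
    refine ⟨hs, ext_coeff fun n => ?_⟩
    rw [coeff_neg_opL hB hs]
    by_cases hn : n ∈ s
    · rw [coeff_truncation_of_mem hn, coeff_truncation_of_mem hn]
      exact h n
    · rw [coeff_truncation_of_notMem hn, coeff_truncation_of_notMem hn, map_zero]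

theorem IsFreeSemigroup.coeff_apply (hB : B = Matrix.fromBlocks 0 0 0 D)
    {S : ℝ≥0 → State dh dp →L[ℂ] State dh dp} (hS : IsFreeSemigroup A B K S) (t : ℝ≥0) (n : ℤ)
    (f : State dh dp) : coeff n (S t f) = flow (matrixSymbol A B K n) t (coeff n f) :=
  hS.1.coeff_apply (hS.2.trans (closure_negLGraph hB)) t n f

theorem existsUnique_isFreeSemigroup (hB : B = Matrix.fromBlocks 0 0 0 D)
    (hbd : ∀ T : ℝ, ∃ C : ℝ, 0 ≤ C ∧ ∀ n : ℤ, ∀ t ∈ Set.Icc 0 T,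
      ‖flow (matrixSymbol A B K n) t‖ ≤ C) : ∃! S, IsFreeSemigroup A B K S := by
  obtain ⟨S, hS⟩ := exists_multiplier_semigroup hbd
  refine ⟨S, ⟨isC0Semigroup_of_coeff hbd hS, ?_⟩, fun S' hS' => ?_⟩
  · rw [closure_negLGraph hB, generatorGraph_eq_symbolGraph hbd hS]
  · funext t
    ext1 f
    exact ext_coeff fun n => by rw [hS, hS'.coeff_apply hB]

/-! ### Sobolev regularity from bounds on Fourier coefficients -/

theorem summable_of_smoothing {F E : Type*} [NormedAddCommGroup E] [NormedSpace ℂ E]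
    [NormedAddCommGroup F] [NormedSpace ℂ F] (eh : (Fin dh → ℂ) →ₗ[ℂ] E)
    (ep : (Fin dp → ℂ) →ₗ[ℂ] F) {k : ℕ} {f : State dh dp} (hf : f ∈ sobolev dh dp k 0) (C : ℝ) :
    Summable fun n : ℤ => (C * (|(n : ℝ)| ^ k * ‖restrictCLM eh Sum.inl (coeff n f)‖
      + ‖restrictCLM ep Sum.inr (coeff n f)‖)) ^ 2 := by
  obtain ⟨Mh, hMh0, hMh⟩ := exists_norm_apply_le eh
  obtain ⟨Mp, hMp0, hMp⟩ := exists_norm_apply_le ep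
  have h1 : Summable fun n : ℤ => (|(n : ℝ)| ^ k * ‖coeff n f ∘ Sum.inl‖) ^ 2 :=
    summable_sq_mul_norm fun i => by
      simpa only [Function.comp_apply, ParabolicTransport.coeff_apply] using (memH_iff k _).1 (hf.1 i)
  have h2 : Summable fun n : ℤ => (1 * ‖coeff n f ∘ Sum.inr‖) ^ 2 :=
    summable_sq_mul_norm fun j => by
      simpa only [Function.comp_apply, ParabolicTransport.coeff_apply, pow_zero] using
        (memH_iff 0 _).1 (hf.2 j)
  refine ((h1.mul_left (2 * C ^ 2 * Mh ^ 2)).add (h2.mul_left (2 * C ^ 2 * Mp ^ 2))).of_nonneg_of_le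
    (fun n => by positivity) fun n => ?_
  rw [restrictCLM_apply, restrictCLM_apply, mul_pow]
  set x := |(n : ℝ)| ^ k * ‖coeff n f ∘ Sum.inl‖
  set y := ‖coeff n f ∘ Sum.inr‖
  have h3 : |(n : ℝ)| ^ k * ‖eh (coeff n f ∘ Sum.inl)‖ ≤ Mh * x := by
    calc _ ≤ |(n : ℝ)| ^ k * (Mh * ‖coeff n f ∘ Sum.inl‖) := by gcongr; exact hMh _
      _ = _ := by simp only [x]; ring
  have h4 : ‖ep (coeff n f ∘ Sum.inr)‖ ≤ Mp * y := hMp _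
  calc _ ≤ C ^ 2 * (Mh * x + Mp * y) ^ 2 := by gcongr
    _ ≤ C ^ 2 * (2 * ((Mh * x) ^ 2 + (Mp * y) ^ 2)) := by
        gcongr
        nlinarith [sq_nonneg (Mh * x - Mp * y)]
    _ = _ := by ring

theorem memH_of_bound {k : ℕ} {g : State dh dp} {b : ℤ → ℝ} (hb : Summable fun n => b n ^ 2) {N : ℝ}
    (h : ∀ n : ℤ, N ≤ |(n : ℝ)| → |(n : ℝ)| ^ k * ‖coeff n g‖ ≤ b n) (i : Fin dh ⊕ Fin dp) :
    MemH k (g i) := by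
  rw [memH_iff]
  -- Only finitely many integers have absolute value below `N`, so they do not affect summability.
  refine hb.of_norm_bounded_eventually ?_
  have hev : ∀ᶠ n : ℤ in cofinite, N ≤ |(n : ℝ)| := by
    have := (tendsto_norm_cocompact_atTop (E := ℝ)).comp Int.tendsto_coe_cofinite
    exact this.eventually_ge_atTop N
  filter_upwards [hev] with n hn
  rw [Real.norm_of_nonneg (by positivity), ← ParabolicTransport.coeff_apply]
  refine pow_le_pow_left₀ (by positivity) (le_trans ?_ (h n hn)) 2
  gcongr
  exact norm_le_pi_norm (coeff n g) i

end ParabolicTransport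

end
theorem mainTheorem11 (dh dp : ℕ) (hdh : 1 ≤ dh) (hdp : 1 ≤ dp)
    (A B K : Matrix (Fin dh ⊕ Fin dp) (Fin dh ⊕ Fin dp) ℝ)
    (D : Matrix (Fin dp) (Fin dp) ℝ)
    (hB : B = Matrix.fromBlocks 0 0 0 D)
    (hD : ∀ μ ∈ spectrum ℂ (ParabolicTransport.toComplex D), 0 < μ.re)
    (hA : ParabolicTransport.IsDiagonalizable (ParabolicTransport.toComplex A.toBlocks₁₁))
    (hA_real : ∀ μ ∈ spectrum ℂ (ParabolicTransport.toComplex A.toBlocks₁₁), μ.im = 0) :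
    (∃! S, ParabolicTransport.IsFreeSemigroup A B K S) ∧
    ∀ S, ParabolicTransport.IsFreeSemigroup A B K S →
      (∀ f₀ ∈ ParabolicTransport.sobolev dh dp 1 0, ∀ t : ℝ≥0, 0 < t →
        S t f₀ ∈ ParabolicTransport.sobolev dh dp 1 1) ∧
      (A.toBlocks₁₂ = 0 → ∀ f₀ ∈ ParabolicTransport.sobolev dh dp 2 0, ∀ t : ℝ≥0, 0 < t →
        S t f₀ ∈ ParabolicTransport.sobolev dh dp 2 2) := by
  open ParabolicTransport in
  obtain ⟨F, iF, iF', eh, ep, c, β, M, H, hβ⟩ := exists_isAdapted A B D hB hD hA hA_real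
  refine ⟨existsUnique_isFreeSemigroup hB (H.exists_uniform_bound (complexAction K)),
    fun S hS => ?_⟩
  -- Both regularity claims are one statement in `k`, the number of derivatives gained over the
  -- parabolic data; `k = 2` requires `β = 0`, which `hβ` derives from `A₁₂ = 0`.
  have key : ∀ k : ℕ, (k = 1 ∨ k = 2 ∧ β = 0) → ∀ f₀ ∈ sobolev dh dp k 0, ∀ t : ℝ≥0, 0 < t →
      S t f₀ ∈ sobolev dh dp k k := by
    intro k hk f₀ hf₀ t ht
    obtain ⟨C, N, hC⟩ := H.exists_smoothing_bound (complexAction K) hk (t := t)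
      (NNReal.coe_pos.2 ht)
    have hmem := memH_of_bound (g := S t f₀) (summable_of_smoothing eh ep hf₀ C)
      fun n hn => by
        rw [hS.coeff_apply hB]
        exact hC n hn (coeff n f₀)
    exact ⟨fun i => hmem _, fun j => hmem _⟩
  exact ⟨key 1 (Or.inl rfl), fun h0 => key 2 (Or.inr ⟨rfl, hβ h0⟩)⟩
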